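/- Let $k,r\ge 0$ be integers and $[k]=\{1,\dots,k\}$. Let $G$ be a finite simple graph with no induced subgraph isomorphic to $P_5+rK_1$ (the disjoint union of a path on five vertices and $r$ isolated vertices). Let $\omega:V(G)\to\mathbb R_{\ge 0}$ be a weight function and let $L$ be a list assignment with $L(v)\subseteq[k]$ for all $v\in V(G)$. For $R\subseteq V(G)$ and lists $L'(v)\subseteq[k]$, an *optimum solution* on $G[R]$ with lists $L'$ is an induced subgraph $G[T]$, $T\subseteq R$, that is $L'$-colourable (it has a proper colouring with $v$ coloured from $L'(v)$) and has maximum total weight $\omega(T)=\sum_{v\in T}\omega(v)$ among all $L'$-colourable induced subgraphs of $G[R]$. For $T\subseteq V(G)$ let $N(T)$ be the set of vertices outside $T$ with a neighbour in $T$; $N(v)$ is the neighbourhood of $v$. Two sets are *anticomplete* if they are disjoint and no edge joins them. A *solver* $U$ for $k-1$ colours is any function that assigns to each $T\subseteq V(G)$ and each list assignment $L'$ a set $U(T,L')\subseteq V(G)$ such that, whenever $|\bigcup_{v\in T}L'(v)|<k$, the set $U(T,L')$ induces an optimum solution on $G[T]$ with lists $L'$. **Canvas.** A canvas for $(G,L)$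 is a tuple $Q=(S,f,\{A_c\},\{B_c\},\{Y_{i,c,\ell}\},\{Z_{i,c}\})$ of the following kind, where $c$ ranges over $[k]$, $i,\ell$ range over $[t]$, and $Y_{i,c,\ell}$ is indexed by $i<\ell$. - (Set $S$) $S=\{v_1,\dots,v_t\}$ is an ordered set of $t$ vertices, $G[S]$ is connected (and non-empty), and $t\le\max\{k,\,(k+2)(r-1)+5\}$. Put $X_i=N(v_i)\setminus(S\cup\bigcup_{j<i}X_j)$, $M=V(G)\setminus(S\cup N(S))$, and $W=\{v\in M: N(v)\cap B_c\ne\emptyset$ for every $c$ with $|B_c|=r\}$. - (Col. $f$) $f$ is an $L$-colouring of $G[S]$. - (Sets) All of $A_c,B_c,Y_{i,c,\ell},Z_{i,c}$ are independent sets of vertices whose lists contain $c$; $A_c\subseteq N(S)$ and $|A_c|\le 2k$; $B_c\subseteq M$ and $|B_c|\le r$; $Y_{i,c,\ell}\subseteq X_i$ and $|Y_{i,c,\ell}|\le 2$; $Z_{i,c}\subseteq X_i$ and $|Z_{i,c}|\le r$. - (Small $Z$) If $|Z_{i,c}|<r$, then $Y_{i,c,\ell}\subseteq Z_{i,c}$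 for all $\ell>i$, and $A_c\cap X_i\subseteq Z_{i,c}$. - (Disjoint) For all $c\ne d$, all $i$, and all $\ell,m>i$, the following pairs are disjoint: $A_c,A_d$; $B_c,B_d$; $Z_{i,c},Z_{i,d}$; $Y_{i,c,\ell},Y_{i,d,m}$; $A_c,Y_{i,d,\ell}$; $A_c,Z_{i,d}$; $Y_{i,c,\ell},Z_{i,d}$. - (Colour) Writing $D_c=A_c\cup\bigcup_{i<\ell}Y_{i,c,\ell}\cup\bigcup_i Z_{i,c}$, the set $\{v_i:f(v_i)=c\}\cup D_c$ is independent for every $c$. - (Comps.) $\bigcup_cB_c$ is anticomplete to $\bigcup_cD_c$. **Component generation algorithm.** Given a canvas $Q$ and a solver $U$, each vertex $v\in N(S)$ lies in exactly one $X_i$. If there is $c$ with $v\in A_c\cup\bigcup_{j>i}Y_{i,c,j}\cup\bigcup_{j}Z_{j,c}$ (there is at most one such $c$), put $F(v)=[k]\setminus\{c\}$. Otherwise $F(v)$ is the set of all $c\in[k]$ that satisfy at least one of: - $c=f(v_j)$ for some neighbour $v_j\in S$ of $v$; - $N(v)\cap(M\setminus W)\not\subseteq N(A_c)$; - $v\in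 N\big(A_c\cup B_c\cup\bigcup_{\ell}Z_{\ell,c}\cup\bigcup_{\ell<j}Y_{\ell,c,j}\big)$; - $|Z_{i,c}|<r$; - for some $j>i$, $|Z_{j,c}|=r$ and $(N(v)\cap X_j)\setminus N(Z_{j,c})\not\subseteq (N(Y_{i,c,j})\cap X_j)\setminus N(Z_{j,c})$. Let $L_Q(v)=L(v)\setminus F(v)$ for $v\in N(S)$ and $L_Q(v)=L(v)$ for all other $v$. The output on $Q$ is the subgraph of $G$ induced by $$S\cup\bigcup_{i\in[t]}U\Big(X_i\setminus N\big(\textstyle\bigcup_{c}B_c\big),\,L_Q\Big).$$ **Lemma.** For every solver $U$ for $k-1$ colours there is an optimum solution $OPT$ on $G$ with lists $L$ such that every connected component of $OPT$ is the output of the component generation algorithm, run with $U$, on some canvas for $(G,L)$. -/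

import Mathlib

namespace ListWMkCIS

open scoped NNReal

/-- The graph `P_5 + rK_1`: the disjoint union of a path on five vertices and `r` isolated
vertices. -/
def pathFivePlus (r : ℕ) : SimpleGraph (Fin 5 ⊕ Fin r) :=
  SimpleGraph.sum (SimpleGraph.pathGraph 5) (⊥ : SimpleGraph (Fin r))

/-- `G` has no induced subgraph isomorphic to `P_5 + rK_1`. -/
def PathFivePlusFree {V : Type*} (G : SimpleGraph V) (r : ℕ) : Prop :=
  ¬ (pathFivePlus r).IsIndContained G

/-- The subgraph of `G` induced by `T` has a proper colouring in which every vertex `v` receives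
a colour from its list `L v`. -/
def ListColorable {V : Type*} {k : ℕ} (G : SimpleGraph V) (L : V → Finset (Fin k))
    (T : Finset V) : Prop :=
  ∃ φ : (G.induce (T : Set V)).Coloring (Fin k), ∀ v, φ v ∈ L v.1

/-- `T` is the vertex set of an optimum solution of the list version of the weighted maximum
`k`-colourable induced subgraph problem on the graph `G[R]`, with weights `ω` and lists `L`. -/
def IsOptimum {V : Type*} {k : ℕ} (G : SimpleGraph V) (ω : V → ℝ≥0) (L : V → Finset (Fin k))
    (R T : Finset V) : Prop :=
  T ⊆ R ∧ ListColorable G L T ∧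
    ∀ T' : Finset V, T' ⊆ R → ListColorable G L T' → ∑ v ∈ T', ω v ≤ ∑ v ∈ T, ω v

open Classical in
/-- `U` solves the list version of the problem with at most `k - 1` colours on induced subgraphs
of `G`: whenever fewer than `k` colours occur in the lists of the vertices of `T`, the set
`U T L` is an optimum solution on `G[T]` with lists `L`. Nothing is asked of `U` otherwise. -/
def IsSolver {V : Type*} {k : ℕ} (G : SimpleGraph V) (ω : V → ℝ≥0)
    (U : Finset V → (V → Finset (Fin k)) → Finset V) : Prop :=
  ∀ (T : Finset V) (L : V → Finset (Fin k)),
    (T.biUnion L).card < k → IsOptimum G ω L T (U T L)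

/-- No vertex of `T` has another vertex of `T` as a neighbour. -/
def Indep {V : Type*} (G : SimpleGraph V) (T : Finset V) : Prop :=
  G.IsIndepSet (T : Set V)

/-- `T` and `T'` are disjoint and there is no edge between them. -/
def Anticomplete {V : Type*} (G : SimpleGraph V) (T T' : Finset V) : Prop :=
  Disjoint T T' ∧ ∀ u ∈ T, ∀ v ∈ T', ¬ G.Adj u v

open Classical in
/-- `N(T)`: the vertices outside `T` that have a neighbour in `T`. -/
noncomputable def nbr {V : Type*} [Fintype V] (G : SimpleGraph V) (T : Finset V) : Finset V :=
  {x | x ∉ T ∧ ∃ u ∈ T, G.Adj u x}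

open Classical in
/-- `N(v)`. -/
noncomputable def nbr₁ {V : Type*} [Fintype V] (G : SimpleGraph V) (v : V) : Finset V :=
  {x | G.Adj v x}

/-- The bare data of a canvas. The ordered set `S` is `v 0, …, v (t - 1)`, the colour of `v i` is
`f i`, and `Y i c l` stands for `Y_{i,c,l}`; only its values with `i < l` are ever used. -/
structure Tuple (V : Type*) (k : ℕ) where
  t : ℕ
  v : Fin t ↪ V
  f : Fin t → Fin k
  A : Fin k → Finset V
  B : Fin k → Finset V
  Y : Fin t → Fin k → Fin t → Finset V
  Z : Fin t → Fin k → Finset V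

namespace Tuple

variable {V : Type*} [Fintype V] {k : ℕ}

/-- The underlying set of the ordered set `S`. -/
def S (Q : Tuple V k) : Finset V := Finset.univ.map Q.v

open Classical in
/-- `X_i`: the vertices outside `S` whose first neighbour in the ordered set `S` is `v_i`. -/
noncomputable def X (Q : Tuple V k) (G : SimpleGraph V) (i : Fin Q.t) : Finset V :=
  {x | x ∉ Q.S ∧ G.Adj (Q.v i) x ∧ ∀ j < i, ¬ G.Adj (Q.v j) x}

open Classical in
/-- The usual recursive description of `X_i`. -/
theorem X_eq (Q : Tuple V k) (G : SimpleGraph V) (i : Fin Q.t) :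
    Q.X G i = nbr₁ G (Q.v i) \ (Q.S ∪ (Finset.univ.filter (· < i)).biUnion (Q.X G)) := by
  ext x
  simp only [X, nbr₁, Finset.mem_filter, Finset.mem_univ, true_and, Finset.mem_sdiff,
    Finset.mem_union, Finset.mem_biUnion, not_or, not_exists, not_and]
  constructor
  · rintro ⟨hS, hi, hj⟩
    exact ⟨hi, hS, fun j hji _ hadj => absurd hadj (hj j hji)⟩
  · rintro ⟨hi, hS, hj⟩
    refine ⟨hS, hi, fun j => ?_⟩
    induction j using WellFoundedLT.induction with
    | ind j ih =>
      intro hji hadj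
      exact hj j hji hS hadj (fun l hl => ih l hl (hl.trans hji))

open Classical in
/-- `M`: the vertices neither in `S` nor in `N(S)`. -/
noncomputable def M (Q : Tuple V k) (G : SimpleGraph V) : Finset V :=
  Finset.univ \ (Q.S ∪ nbr G Q.S)

open Classical in
/-- `W`: the vertices of `M` with a neighbour in every `B_c` that has exactly `r` elements. -/
noncomputable def W (Q : Tuple V k) (G : SimpleGraph V) (r : ℕ) : Finset V :=
  {x ∈ Q.M G | ∀ c, (Q.B c).card = r → (nbr₁ G x ∩ Q.B c).Nonempty}

open Classical in
/-- The union of all `Y_{i,c,l}` with `i < l`, for a fixed colour `c`. -/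
noncomputable def YAll (Q : Tuple V k) (c : Fin k) : Finset V :=
  {x | ∃ i l, i < l ∧ x ∈ Q.Y i c l}

open Classical in
/-- The union of all `Z_{i,c}`, for a fixed colour `c`. -/
noncomputable def ZAll (Q : Tuple V k) (c : Fin k) : Finset V :=
  Finset.univ.biUnion fun i => Q.Z i c

open Classical in
/-- `A_c`, all `Y_{i,c,l}` with `i < l`, and all `Z_{i,c}` together. -/
noncomputable def guess (Q : Tuple V k) (c : Fin k) : Finset V :=
  Q.A c ∪ Q.YAll c ∪ Q.ZAll c

open Classical in
/-- The union of all `B_c`. -/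
noncomputable def BAll (Q : Tuple V k) : Finset V :=
  Finset.univ.biUnion Q.B

open Classical in
/-- The tuple `Q` is a canvas for the graph `G` with list assignment `L`. -/
structure IsCanvas (Q : Tuple V k) (G : SimpleGraph V) (r : ℕ) (L : V → Finset (Fin k)) :
    Prop where
  card_S : (Q.t : ℤ) ≤ max (k : ℤ) (((k : ℤ) + 2) * ((r : ℤ) - 1) + 5)
  connected_S : (G.induce (Q.S : Set V)).Connected
  f_list : ∀ i, Q.f i ∈ L (Q.v i)
  f_proper : ∀ i j, G.Adj (Q.v i) (Q.v j) → Q.f i ≠ Q.f j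
  A_sub : ∀ c, Q.A c ⊆ nbr G Q.S
  A_indep : ∀ c, Indep G (Q.A c)
  A_card : ∀ c, (Q.A c).card ≤ 2 * k
  A_list : ∀ c, ∀ x ∈ Q.A c, c ∈ L x
  B_sub : ∀ c, Q.B c ⊆ Q.M G
  B_indep : ∀ c, Indep G (Q.B c)
  B_card : ∀ c, (Q.B c).card ≤ r
  B_list : ∀ c, ∀ x ∈ Q.B c, c ∈ L x
  Y_sub : ∀ i c l, i < l → Q.Y i c l ⊆ Q.X G i
  Y_indep : ∀ i c l, i < l → Indep G (Q.Y i c l)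
  Y_card : ∀ i c l, i < l → (Q.Y i c l).card ≤ 2
  Y_list : ∀ i c l, i < l → ∀ x ∈ Q.Y i c l, c ∈ L x
  Z_sub : ∀ i c, Q.Z i c ⊆ Q.X G i
  Z_indep : ∀ i c, Indep G (Q.Z i c)
  Z_card : ∀ i c, (Q.Z i c).card ≤ r
  Z_list : ∀ i c, ∀ x ∈ Q.Z i c, c ∈ L x
  small_Z_Y : ∀ i c, (Q.Z i c).card < r → ∀ l, i < l → Q.Y i c l ⊆ Q.Z i c
  small_Z_A : ∀ i c, (Q.Z i c).card < r → Q.A c ∩ Q.X G i ⊆ Q.Z i c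
  disj_A : ∀ c d, c ≠ d → Disjoint (Q.A c) (Q.A d)
  disj_B : ∀ c d, c ≠ d → Disjoint (Q.B c) (Q.B d)
  disj_Z : ∀ i c d, c ≠ d → Disjoint (Q.Z i c) (Q.Z i d)
  disj_Y : ∀ i c d l m, c ≠ d → i < l → i < m → Disjoint (Q.Y i c l) (Q.Y i d m)
  disj_A_Y : ∀ i c d l, c ≠ d → i < l → Disjoint (Q.A c) (Q.Y i d l)
  disj_A_Z : ∀ i c d, c ≠ d → Disjoint (Q.A c) (Q.Z i d)
  disj_Y_Z : ∀ i c d l, c ≠ d → i < l → Disjoint (Q.Y i c l) (Q.Z i d)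
  colour : ∀ c, Indep G ((Finset.univ.filter fun i => Q.f i = c).map Q.v ∪ Q.guess c)
  comps : Anticomplete G Q.BAll (Finset.univ.biUnion Q.guess)

/-- The test in the component generation algorithm for a vertex `x` of `X_i` and a colour `c`:
`x` lies in `A_c`, in some `Y_{i,c,j}` with `j > i`, or in some `Z_{j,c}`. -/
def Fixed (Q : Tuple V k) (i : Fin Q.t) (x : V) (c : Fin k) : Prop :=
  x ∈ Q.A c ∨ (∃ j, i < j ∧ x ∈ Q.Y i c j) ∨ ∃ j, x ∈ Q.Z j c

open Classical in
/-- The set `F(x)` of colours which the component generation algorithm forbids at a vertex `x`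
of `X_i`. -/
noncomputable def forbidden (Q : Tuple V k) (G : SimpleGraph V) (r : ℕ) (i : Fin Q.t) (x : V) :
    Finset (Fin k) :=
  if ∃ c, Q.Fixed i x c then
    Finset.univ.filter fun d => ∃ c, Q.Fixed i x c ∧ d ≠ c
  else
    Finset.univ.filter fun c => (∃ j, G.Adj x (Q.v j) ∧ Q.f j = c) ∨
      ¬ (nbr₁ G x ∩ (Q.M G \ Q.W G r) ⊆ nbr G (Q.A c)) ∨
      x ∈ nbr G (Q.A c ∪ Q.B c ∪ Q.ZAll c ∪ Q.YAll c) ∨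
      (Q.Z i c).card < r ∨
      ∃ j, i < j ∧ (Q.Z j c).card = r ∧
        ¬ ((nbr₁ G x ∩ Q.X G j) \ nbr G (Q.Z j c) ⊆
          (nbr G (Q.Y i c j) ∩ Q.X G j) \ nbr G (Q.Z j c))

open Classical in
/-- The list assignment `L` after the update by the component generation algorithm: the list of
every vertex `x` of `N(S)` is replaced by `L(x) \ F(x)`. Each such `x` lies in exactly one
`X_i`. -/
noncomputable def newList (Q : Tuple V k) (G : SimpleGraph V) (r : ℕ) (L : V → Finset (Fin k))
    (x : V) : Finset (Fin k) :=
  {c ∈ L x | ∀ i, x ∈ Q.X G i → c ∉ Q.forbidden G r i x}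

open Classical in
/-- The vertex set of the induced subgraph returned by the component generation algorithm, run
with the solver `U` for `k - 1` colours: `S` together with the solutions returned by `U` on the
sets `X_i \ N(⋃ B_c)` with the updated lists. -/
noncomputable def output (Q : Tuple V k) (G : SimpleGraph V) (r : ℕ) (L : V → Finset (Fin k))
    (U : Finset V → (V → Finset (Fin k)) → Finset V) : Finset V :=
  Q.S ∪ Finset.univ.biUnion fun i => U (Q.X G i \ nbr G Q.BAll) (Q.newList G r L)

end Tuple

end ListWMkCIS

/-! Take an optimum `O`, a list colouring `φ` of it and a component `C` of `G[O]`. A canvas is read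
off from `φ` (`Tuple.exists_guided`), and the output on it can replace `C` without loss of weight
(`Tuple.Guided.exchange`). An optimum with the fewest components that are not outputs therefore has
none.

The set `S` is a small connected dominating set of `G[C]` (`IsCDS.exists_card_le`). If `C` contains
no induced path on five vertices, a minimum one has at most `k` vertices. Otherwise such a path is
grown until it dominates; every growth step yields a further vertex of an independent set
anticomplete to the path, so fewer than `r` steps are possible.

The sets `B_c` and `Z_{i,c}` hold `r` vertices of colour `c` from `O \ C` and from `C ∩ X_i`, or all
of them if there are fewer. A full one supplies the `r` isolated vertices of a forbidden subgraph.
Outside its neighbourhood, three equally coloured vertices of `C` cannot all have private neighbours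
of the relevant kind, so two of them dominate what their whole class sees (`exists_pair_dominating`,
`PathFivePlusFree.not_three_private`). These pairs form `A_c` and `Y_{i,c,l}`.

The updated lists keep `φ x` at every `x` in `C ∩ X_i`, so `C ∩ X_i` competes with the solver's
answer on `X_i`. The colour of `v_i` has left all lists on `X_i`, so the solver applies. The lists
also rule out conflicts between different `X_i` and edges to `O \ C`, so the separate answers glue
together. -/

namespace ListWMkCIS

open scoped NNReal

section Graph

open Classical

variable {V : Type*} {G : SimpleGraph V}

/-! ### The forbidden subgraph -/

/-- `a, b, c, d, e` are, in this order, the vertices of an induced path on five vertices. -/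
def IndPath5 (G : SimpleGraph V) (a b c d e : V) : Prop :=
  (G.Adj a b ∧ G.Adj b c ∧ G.Adj c d ∧ G.Adj d e) ∧
    ¬ G.Adj a c ∧ ¬ G.Adj a d ∧ ¬ G.Adj a e ∧ ¬ G.Adj b d ∧ ¬ G.Adj b e ∧ ¬ G.Adj c e

theorem PathFivePlusFree.not_indPath5 {r : ℕ} (hG : PathFivePlusFree G r) {a b c d e : V}
    (hP : IndPath5 G a b c d e) {B : Finset V} (hB : Indep G B) (hr : r ≤ B.card)
    (hBP : ∀ x ∈ B, ¬ G.Adj x a ∧ ¬ G.Adj x b ∧ ¬ G.Adj x c ∧ ¬ G.Adj x d ∧ ¬ G.Adj x e) :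
    False := by
  obtain ⟨⟨hab, hbc, hcd, hde⟩, hac, had, hae, hbd, hbe, hce⟩ := hP
  obtain ⟨g⟩ : Nonempty (Fin r ↪ B) :=
    Function.Embedding.nonempty_of_card_le (by simpa using hr)
  let p : Fin 5 → V := ![a, b, c, d, e]
  have hp : ∀ i j, (SimpleGraph.pathGraph 5).Adj i j ↔ G.Adj (p i) (p j) := by
    intro i j
    fin_cases i <;> fin_cases j <;> simp [p, SimpleGraph.pathGraph_adj, G.adj_comm, *]
  have hpi : Function.Injective p := by
    have hne : a ≠ b ∧ a ≠ c ∧ a ≠ d ∧ a ≠ e ∧ b ≠ c ∧ b ≠ d ∧ b ≠ e ∧ c ≠ d ∧ c ≠ e ∧ d ≠ e := by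
      refine ⟨hab.ne, ?_, ?_, ?_, hbc.ne, ?_, ?_, hcd.ne, ?_, hde.ne⟩
      · rintro rfl; exact had hcd
      · rintro rfl; exact hae hde
      · rintro rfl; exact had hde.symm
      · rintro rfl; exact hbe hde
      · rintro rfl; exact hce hbc.symm
      · rintro rfl; exact hbe hbc
    intro i j
    fin_cases i <;> fin_cases j <;> simp [p] <;> grind
  have hgp : ∀ i j, ¬ G.Adj (g i : V) (p j) := by
    intro i j
    have := hBP _ (g i).2
    fin_cases j <;> simp [p, this]
  -- Every path vertex has a neighbour on the path, whereas vertices of `B` have none.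
  have hne : ∀ i j, (g i : V) ≠ p j := by
    intro i j h
    obtain ⟨l, hl⟩ : ∃ l, G.Adj (p j) (p l) := by
      fin_cases j
      exacts [⟨1, hab⟩, ⟨2, hbc⟩, ⟨3, hcd⟩, ⟨4, hde⟩, ⟨3, hde.symm⟩]
    exact hgp i l (h ▸ hl)
  refine hG ⟨⟨⟨Sum.elim p fun i => (g i : V), ?_⟩, ?_⟩⟩
  · rintro (i | i) (j | j) h
    · simpa using hpi (by simpa using h)
    · exact absurd h.symm (hne j i)
    · exact absurd h (hne i j)
    · simpa using h
  · rintro (i | i) (j | j)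
    · exact (hp i j).symm
    · exact iff_of_false (fun h => hgp j i h.symm) (by simp [pathFivePlus])
    · exact iff_of_false (hgp i j) (by simp [pathFivePlus])
    · refine iff_of_false (fun h => ?_) (by simp [pathFivePlus])
      exact hB (g i).2 (g j).2 h.ne h

/-! ### Connectedness through edge cuts -/

/-- A nonempty finite set of vertices such that an edge leaves each of its nonempty proper
subsets. -/
def Conn (G : SimpleGraph V) (D : Finset V) : Prop :=
  D.Nonempty ∧ ∀ E ⊆ D, E.Nonempty → E ≠ D → ∃ a ∈ E, ∃ b ∈ D, b ∉ E ∧ G.Adj a b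

theorem Conn.connected {D : Finset V} (hD : Conn G D) : (G.induce (D : Set V)).Connected := by
  have : Nonempty (D : Set V) := hD.1.to_subtype
  refine ⟨fun x y => ?_⟩
  let E := D.filter fun z => ∃ hz : z ∈ (D : Set V), (G.induce (D : Set V)).Reachable x ⟨z, hz⟩
  have hE : E = D := by
    by_contra h
    obtain ⟨a, ha, b, hb, hbE, hab⟩ := hD.2 E (Finset.filter_subset _ _)
      ⟨x, Finset.mem_filter.2 ⟨x.2, x.2, SimpleGraph.Reachable.refl _⟩⟩ h
    obtain ⟨_, ha', hr⟩ := Finset.mem_filter.1 ha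
    refine hbE (Finset.mem_filter.2 ⟨hb, hb, hr.trans (SimpleGraph.Adj.reachable ?_)⟩)
    simpa using hab
  have hy : (y : V) ∈ E := by
    rw [hE]
    exact y.2
  exact (Finset.mem_filter.1 hy).2.2

theorem Conn.singleton (x : V) : Conn G {x} := by
  refine ⟨by simp, fun E hE hne h => ?_⟩
  rcases Finset.subset_singleton_iff.1 hE with rfl | rfl
  · simp at hne
  · exact absurd rfl h

theorem Conn.insert_of_adj {D : Finset V} (hD : Conn G D) {a x : V} (ha : a ∈ D) (hax : G.Adj a x) :
    Conn G (insert x D) := by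
  refine ⟨by simp, fun E hE hne h => ?_⟩
  by_cases h1 : (E ∩ D).Nonempty
  · by_cases h2 : E ∩ D = D
    · have hDE : D ⊆ E := Finset.inter_eq_right.1 h2
      refine ⟨a, hDE ha, x, by simp, fun hx => h ?_, hax⟩
      exact hE.antisymm (Finset.insert_subset hx hDE)
    · obtain ⟨p, hp, q, hq, hqE, hpq⟩ := hD.2 _ Finset.inter_subset_right h1 h2
      refine ⟨p, (Finset.mem_inter.1 hp).1, q, by simp [hq], fun h => hqE ?_, hpq⟩
      exact Finset.mem_inter.2 ⟨h, hq⟩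
  · obtain ⟨y, hy⟩ := hne
    have hyx : y = x := by
      rcases Finset.mem_insert.1 (hE hy) with h | h
      · exact h
      · exact absurd ⟨y, Finset.mem_inter.2 ⟨hy, h⟩⟩ h1
    subst hyx
    exact ⟨y, hy, a, by simp [ha], fun h => h1 ⟨a, Finset.mem_inter.2 ⟨h, ha⟩⟩, hax.symm⟩

theorem Conn.of_center {D : Finset V} {u : V} (hu : u ∈ D)
    (h : ∀ v ∈ D, v ≠ u → G.Adj u v ∨ ∃ a ∈ D, G.Adj u a ∧ G.Adj a v) : Conn G D := by
  refine ⟨⟨u, hu⟩, fun E hE hne hED => ?_⟩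
  by_cases huE : u ∈ E
  · obtain ⟨v, hv, hvE⟩ : ∃ v ∈ D, v ∉ E := by
      by_contra! hc
      exact hED (hE.antisymm hc)
    rcases h v hv (by rintro rfl; exact hvE huE) with h | ⟨a, ha, hua, hav⟩
    · exact ⟨u, huE, v, hv, hvE, h⟩
    · by_cases haE : a ∈ E
      · exact ⟨a, haE, v, hv, hvE, hav⟩
      · exact ⟨u, huE, a, ha, haE, hua⟩
  · obtain ⟨v, hvE⟩ := hne
    rcases h v (hE hvE) (by rintro rfl; exact huE hvE) with h | ⟨a, ha, hua, hav⟩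
    · exact ⟨v, hvE, u, hu, huE, h.symm⟩
    · by_cases haE : a ∈ E
      · exact ⟨a, haE, u, hu, huE, hua.symm⟩
      · exact ⟨v, hvE, a, ha, haE, hav.symm⟩

theorem Conn.exists_adj {D : Finset V} (hD : Conn G D) {u v : V} (hu : u ∈ D) (hv : v ∈ D)
    (huv : u ≠ v) : ∃ a ∈ D, a ≠ u ∧ G.Adj u a := by
  obtain ⟨a, ha, b, hb, hba, hab⟩ := hD.2 {u} (by simpa using hu) (by simp)
    (by rintro rfl; simp at hv; exact huv hv.symm)
  simp only [Finset.mem_singleton] at ha hba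
  subst ha
  exact ⟨b, hb, hba, hab⟩

/-- A largest connected proper subset misses exactly one vertex, since it can be extended along an
edge leaving it. -/
theorem Conn.exists_erase {D : Finset V} (hD : Conn G D) {u v : V} (hu : u ∈ D) (hv : v ∈ D)
    (huv : u ≠ v) : ∃ x ∈ D, Conn G (D.erase x) := by
  obtain ⟨E, hE, hmax⟩ := Finset.exists_max_image
    (D.powerset.filter fun E => Conn G E ∧ E ≠ D) Finset.card
    ⟨{u}, by
      simp only [Finset.mem_filter, Finset.mem_powerset, Finset.singleton_subset_iff]
      exact ⟨hu, Conn.singleton u, by rintro rfl; simp at hv; exact huv hv.symm⟩⟩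
  simp only [Finset.mem_filter, Finset.mem_powerset] at hE hmax
  obtain ⟨a, ha, b, hb, hbE, hab⟩ := hD.2 E hE.1 hE.2.1.1 hE.2.2
  have hins : insert b E = D := by
    by_contra hne
    have := hmax _ ⟨Finset.insert_subset hb hE.1, hE.2.1.insert_of_adj ha hab, hne⟩
    rw [Finset.card_insert_of_notMem hbE] at this
    omega
  refine ⟨b, hb, ?_⟩
  rw [← hins, Finset.erase_insert hbE]
  exact hE.2.1

/-! ### Minimum connected dominating sets without an induced five-vertex path -/

/-- `D` is the vertex set of a connected dominating subgraph of `G[C]`. -/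
def IsCDS (G : SimpleGraph V) (C D : Finset V) : Prop :=
  D ⊆ C ∧ Conn G D ∧ ∀ x ∈ C, x ∉ D → ∃ d ∈ D, G.Adj d x

/-- `D` is a connected dominating set of `G[C]` of minimum size. -/
def IsMinCDS (G : SimpleGraph V) (C D : Finset V) : Prop :=
  IsCDS G C D ∧ ∀ D', IsCDS G C D' → D.card ≤ D'.card

namespace IsMinCDS

variable {C D : Finset V}

/-- By minimality `D.erase u` fails to dominate some vertex. That vertex is not `u`, which has a
neighbour in the connected set `D`. -/
theorem exists_private (hD : IsMinCDS G C D) {u : V} (hu : u ∈ D) (hc : Conn G (D.erase u)) :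
    ∃ u' ∈ C, u' ∉ D ∧ G.Adj u u' ∧ ∀ d ∈ D, G.Adj d u' → d = u := by
  obtain ⟨x, hxC, hxD, hx⟩ : ∃ x ∈ C, x ∉ D.erase u ∧ ∀ d ∈ D.erase u, ¬ G.Adj d x := by
    by_contra! hcon
    have := hD.2 _ ⟨(Finset.erase_subset _ _).trans hD.1.1, hc, hcon⟩
    rw [Finset.card_erase_of_mem hu] at this
    have := Finset.card_pos.2 ⟨u, hu⟩
    omega
  obtain ⟨v, hv⟩ := hc.1
  obtain ⟨hvu, hvD⟩ := Finset.mem_erase.1 hv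
  have hxu : x ≠ u := by
    rintro rfl
    obtain ⟨a, ha, hax, hadj⟩ := hD.1.2.1.exists_adj hu hvD hvu.symm
    exact hx a (Finset.mem_erase.2 ⟨hax, ha⟩) hadj.symm
  have hxD' : x ∉ D := fun h => hxD (Finset.mem_erase.2 ⟨hxu, h⟩)
  have huniq : ∀ d ∈ D, G.Adj d x → d = u := fun d hd hdx => by
    by_contra hdu
    exact hx d (Finset.mem_erase.2 ⟨hdu, hd⟩) hdx
  obtain ⟨d, hd, hdx⟩ := hD.1.2.2 x hxC hxD'
  exact ⟨x, hxC, hxD', huniq d hd hdx ▸ hdx, huniq⟩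

variable (hP : ∀ a ∈ C, ∀ b ∈ C, ∀ c ∈ C, ∀ d ∈ C, ∀ e ∈ C, ¬ IndPath5 G a b c d e)
include hP

/-- A vertex of `D` at distance three from `u` would end an induced path `u', u, a, b, e` that
starts at a private neighbour `u'` of `u`. -/
theorem exists_common (hD : IsMinCDS G C D) {u : V} (hu : u ∈ D) (hc : Conn G (D.erase u)) :
    ∀ v ∈ D, v ≠ u → G.Adj u v ∨ ∃ a ∈ D, G.Adj u a ∧ G.Adj a v := by
  obtain ⟨u', hu'C, hu'D, huu', hpriv⟩ := hD.exists_private hu hc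
  let E := D.filter fun z => z = u ∨ G.Adj u z ∨ ∃ a ∈ D, G.Adj u a ∧ G.Adj a z
  have hE : E = D := by
    by_contra hne
    obtain ⟨b, hb, e, he, heE, hbe⟩ := hD.1.2.1.2 E (Finset.filter_subset _ _)
      ⟨u, by simp [E, hu]⟩ hne
    simp only [E, Finset.mem_filter, not_and, not_or, not_exists] at hb heE
    obtain ⟨heu, hue, hne2⟩ := heE he
    obtain ⟨hbD, hb⟩ := hb
    have hub : ¬ G.Adj u b := fun h => hne2 b hbD h hbe
    have hbu : b ≠ u := by rintro rfl; exact hue hbe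
    obtain ⟨a, ha, hua, hab⟩ := (hb.resolve_left hbu).resolve_left hub
    have hs := hD.1.1
    exact hP u' hu'C u (hs hu) a (hs ha) b (hs hbD) e (hs he)
      ⟨⟨huu'.symm, hua, hab, hbe⟩, fun h => hua.ne (hpriv a ha h.symm).symm,
        fun h => hbu (hpriv b hbD h.symm), fun h => heu (hpriv e he h.symm), hub, hue,
        fun h => hne2 a ha hua h⟩
  intro v hv hvu
  have : v ∈ E := hE ▸ hv
  exact ((Finset.mem_filter.1 this).2).resolve_left hvu

/-- Everything is within two steps of `u`, and no middle vertex is the non-neighbour `v`. -/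
theorem conn_erase (hD : IsMinCDS G C D) {u v : V} (hu : u ∈ D) (hc : Conn G (D.erase u))
    (huv : u ≠ v) (hadj : ¬ G.Adj u v) : Conn G (D.erase v) := by
  refine Conn.of_center (u := u) (Finset.mem_erase.2 ⟨huv, hu⟩) fun w hw hwu => ?_
  rcases exists_common hP hD hu hc w (Finset.mem_erase.1 hw).2 hwu with h | ⟨a, ha, hua, haw⟩
  · exact Or.inl h
  · exact Or.inr ⟨a, Finset.mem_erase.2 ⟨by rintro rfl; exact hadj hua, ha⟩, hua, haw⟩

/-- With `a` a common neighbour of `u` and `v`, a private neighbour `z` of `v` not adjacent to `u'`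
would give the induced path `z, v, a, u, u'`. So `u'` takes over all vertices that only `v`
dominates, and `u', u, a, v, v'` is a five-cycle. -/
theorem exists_swap (hD : IsMinCDS G C D) {u v : V} (hu : u ∈ D) (hc : Conn G (D.erase u))
    (hv : v ∈ D) (huv : u ≠ v) (hadj : ¬ G.Adj u v) :
    ∃ u' ∈ C, u' ∉ D ∧ (∀ d ∈ D, G.Adj d u' → d = u) ∧
      IsMinCDS G C (insert u' (D.erase v)) ∧
      ∃ a ∈ D, ∃ v' ∈ C, G.Adj u' u ∧ G.Adj u a ∧ G.Adj a v ∧ G.Adj v v' ∧ G.Adj v' u' := by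
  have hs := hD.1.1
  obtain ⟨u', hu'C, hu'D, huu', hpu⟩ := hD.exists_private hu hc
  have hcv := conn_erase hP hD hu hc huv hadj
  obtain ⟨v', hv'C, hv'D, hvv', hpv⟩ := hD.exists_private hv hcv
  obtain ⟨a, ha, hua, hav⟩ :=
    (exists_common hP hD hu hc v hv huv.symm).resolve_left hadj
  have key : ∀ z ∈ C, G.Adj v z → (∀ d ∈ D, G.Adj d z → d = v) → G.Adj z u' := by
    intro z hz hvz hpz
    by_contra hn
    exact hP z hz v (hs hv) a (hs ha) u (hs hu) u' hu'C
      ⟨⟨hvz.symm, hav.symm, hua.symm, huu'⟩, fun h => hav.ne (hpz a ha h.symm),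
        fun h => huv (hpz u hu h.symm), hn, fun h => hadj h.symm,
        fun h => huv (hpu v hv h).symm, fun h => hua.ne (hpu a ha h).symm⟩
  refine ⟨u', hu'C, hu'D, hpu, ⟨⟨?_, ?_, ?_⟩, ?_⟩,
    a, ha, v', hv'C, huu'.symm, hua, hav, hvv', key v' hv'C hvv' hpv⟩
  · exact Finset.insert_subset hu'C ((Finset.erase_subset _ _).trans hs)
  · exact hcv.insert_of_adj (Finset.mem_erase.2 ⟨huv, hu⟩) huu'
  · intro z hz hzD
    simp only [Finset.mem_insert, Finset.mem_erase, not_or, not_and] at hzD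
    by_cases hzv : z = v
    · subst hzv
      exact ⟨a, by simp [ha, hav.ne], hav⟩
    · have hzD' := hzD.2 hzv
      by_cases h : ∀ d ∈ D, G.Adj d z → d = v
      · obtain ⟨d, hd, hdz⟩ := hD.1.2.2 z hz hzD'
        exact ⟨u', by simp, (key z hz (h d hd hdz ▸ hdz) h).symm⟩
      · push Not at h
        obtain ⟨d, hd, hdz, hdv⟩ := h
        exact ⟨d, by simp [hd, hdv], hdz⟩
  · intro D' hD'
    rw [Finset.card_insert_of_notMem (by simp [hu'D]), Finset.card_erase_of_mem hv]
    have := hD.2 D' hD'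
    have := Finset.card_pos.2 ⟨v, hv⟩
    omega

/-- In the swapped set, `u` is the only neighbour of `u'`, yet everything is within two steps of
`u'`. -/
theorem adj_of_ne (hD : IsMinCDS G C D) {u v : V} (hu : u ∈ D) (hc : Conn G (D.erase u))
    (hv : v ∈ D) (huv : u ≠ v) (hadj : ¬ G.Adj u v) :
    ∀ w ∈ D, w ≠ u → w ≠ v → G.Adj u w := by
  intro w hw hwu hwv
  obtain ⟨u', hu'C, hu'D, hpu, hmin, -⟩ := exists_swap hP hD hu hc hv huv hadj
  have he : (insert u' (D.erase v)).erase u' = D.erase v :=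
    Finset.erase_insert (by simp [hu'D])
  have hcv := conn_erase hP hD hu hc huv hadj
  rcases exists_common hP hmin (u := u') (by simp) (he.symm ▸ hcv) w (by simp [hw, hwv])
    (by rintro rfl; exact hu'D hw) with h | ⟨a, ha, hua, haw⟩
  · exact absurd (hpu w hw h.symm) hwu
  · have ha' : a ∈ D := by
      rcases Finset.mem_insert.1 ha with rfl | h
      · exact absurd hua (G.loopless.irrefl _)
      · exact Finset.mem_of_mem_erase h
    exact hpu a ha' hua.symm ▸ haw

theorem card_le_three (hD : IsMinCDS G C D) {u v : V} (hu : u ∈ D) (hc : Conn G (D.erase u))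
    (hv : v ∈ D) (huv : u ≠ v) (hadj : ¬ G.Adj u v) : D.card ≤ 3 := by
  obtain ⟨u', hu'C, hu'D, hpu, hmin, a, ha, -, -, -, hua, hav, -⟩ :=
    exists_swap hP hD hu hc hv huv hadj
  have he : (insert u' (D.erase v)).erase u' = D.erase v :=
    Finset.erase_insert (by simp [hu'D])
  have hcv := conn_erase hP hD hu hc huv hadj
  -- In the swapped set `u'` and `a` are non-adjacent, so `u'` is adjacent to all other members; but
  -- its only neighbour there is `u`.
  have hadj' := adj_of_ne hP hmin (u := u') (v := a) (by simp) (he.symm ▸ hcv)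
    (by simp [ha, hav.ne]) (by rintro rfl; exact hu'D ha)
    (fun h => hua.ne (hpu a ha h.symm).symm)
  have hsub : D ⊆ {v, a, u} := by
    intro z hz
    by_contra hcon
    simp only [Finset.mem_insert, Finset.mem_singleton, not_or] at hcon
    exact hcon.2.2 (hpu z hz (hadj' z (by simp [hz, hcon.1]) (by rintro rfl; exact hu'D hz)
      hcon.2.1).symm)
  exact (Finset.card_le_card hsub).trans Finset.card_le_three

theorem card_le {k : ℕ} (hD : IsMinCDS G C D) (φ : V → Fin k)
    (hφ : ∀ u ∈ C, ∀ v ∈ C, G.Adj u v → φ u ≠ φ v) : D.card ≤ k := by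
  have hs := hD.1.1
  by_cases hcl : ∀ u ∈ D, ∀ v ∈ D, u ≠ v → G.Adj u v
  · have := Finset.card_le_card_of_injOn (s := D) (t := Finset.univ) φ (by simp) (by
      intro u hu v hv h
      by_contra hne
      exact hφ u (hs hu) v (hs hv) (hcl u hu v hv hne) h)
    simpa using this
  · push Not at hcl
    obtain ⟨p, hp, q, hq, hpq, hadj⟩ := hcl
    obtain ⟨u, hu, v, hv, huv, huvadj, hc⟩ :
        ∃ u ∈ D, ∃ v ∈ D, u ≠ v ∧ ¬ G.Adj u v ∧ Conn G (D.erase u) := by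
      obtain ⟨x, hx, hcx⟩ := hD.1.2.1.exists_erase hp hq hpq
      by_cases h : ∃ v ∈ D, x ≠ v ∧ ¬ G.Adj x v
      · obtain ⟨v, hv, hxv, hn⟩ := h
        exact ⟨x, hx, v, hv, hxv, hn, hcx⟩
      · push Not at h
        -- If `x` is adjacent to all of `D`, it still serves as a centre after the removal of `p`,
        -- so `p` is not a cut vertex either.
        have hxp : x ≠ p := by
          rintro rfl
          exact hadj (h q hq hpq)
        refine ⟨p, hp, q, hq, hpq, hadj, Conn.of_center (u := x) (by simp [hx, hxp]) ?_⟩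
        exact fun v hv hvx => Or.inl (h v (Finset.mem_of_mem_erase hv) hvx.symm)
    refine (card_le_three hP hD hu hc hv huv huvadj).trans ?_
    -- The five-cycle needs three colours, so `3 ≤ k`.
    obtain ⟨u', hu'C, -, -, -, a, ha, v', hv'C, h1, h2, h3, h4, h5⟩ :=
      exists_swap hP hD hu hc hv huv huvadj
    have e1 := hφ _ hu'C _ (hs hu) h1
    have e2 := hφ _ (hs hu) _ (hs ha) h2
    have e3 := hφ _ (hs ha) _ (hs hv) h3
    have e4 := hφ _ (hs hv) _ hv'C h4
    have e5 := hφ _ hv'C _ hu'C h5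
    rw [Ne, Fin.ext_iff] at e1 e2 e3 e4 e5
    have := (φ u').2
    have := (φ u).2
    have := (φ a).2
    have := (φ v).2
    have := (φ v').2
    omega

end IsMinCDS

/-! ### Connected dominating sets in general -/

/-- As long as `S` does not dominate `C`, some edge `xu` leaves its closed neighbourhood. Adding `x`
and `u` keeps `S` connected, and `u` sees neither the path nor the earlier such vertices. After `r`
steps these vertices and the path would form the forbidden subgraph. -/
theorem IsCDS.exists_of_indPath5 {r : ℕ} (hG : PathFivePlusFree G r) {C : Finset V}
    (hC : Conn G C) {a b c d e : V} (hP : IndPath5 G a b c d e) (ha : a ∈ C) (hb : b ∈ C)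
    (hc : c ∈ C) (hd : d ∈ C) (he : e ∈ C) :
    ∃ S, IsCDS G C S ∧ S.card + 2 ≤ 5 + 2 * r := by
  by_contra hcon
  push Not at hcon
  have key : ∀ n ≤ r, ∃ S I : Finset V, S ⊆ C ∧ Conn G S ∧ {a, b, c, d, e} ⊆ S ∧ I ⊆ S ∧
      I.card = n ∧ S.card ≤ 5 + 2 * n ∧ Indep G I ∧
      ∀ x ∈ I, ∀ y ∈ ({a, b, c, d, e} : Finset V), ¬ G.Adj x y := by
    intro n
    induction n with
    | zero =>
      intro _
      obtain ⟨⟨hab, hbc, hcd, hde⟩, -⟩ := hP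
      refine ⟨{a, b, c, d, e}, ∅, ?_, ?_, subset_rfl, by simp, by simp, ?_, by simp [Indep],
        by simp⟩
      · simp [Finset.insert_subset_iff, *]
      · refine Conn.of_center (u := c) (by simp) fun v hv hvc => ?_
        simp only [Finset.mem_insert, Finset.mem_singleton] at hv
        rcases hv with rfl | rfl | rfl | rfl | rfl
        · exact Or.inr ⟨b, by simp, hbc.symm, hab.symm⟩
        · exact Or.inl hbc.symm
        · exact absurd rfl hvc
        · exact Or.inl hcd
        · exact Or.inr ⟨d, by simp, hcd, hde⟩
      · exact Finset.card_le_five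
    | succ n ih =>
      intro hn
      obtain ⟨S, I, hSC, hS, hPS, hIS, hIn, hcard, hI, hIP⟩ := ih (by omega)
      let E := C.filter fun z => z ∈ S ∨ ∃ s ∈ S, G.Adj s z
      have hE : E ≠ C := by
        intro hE
        have := hcon S ⟨hSC, hS, fun x hx hxS => by
          have hxE : x ∈ E := hE ▸ hx
          exact ((Finset.mem_filter.1 hxE).2).resolve_left hxS⟩
        omega
      obtain ⟨x, hx, u, hu, huE, hxu⟩ := hC.2 E (Finset.filter_subset _ _)
        ⟨a, Finset.mem_filter.2 ⟨ha, Or.inl (hPS (by simp))⟩⟩ hE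
      simp only [E, Finset.mem_filter, not_and, not_or, not_exists] at hx huE
      obtain ⟨huS, hun⟩ := huE hu
      obtain ⟨s, hs, hsx⟩ := hx.2.resolve_left fun h => hun x h hxu
      refine ⟨insert u (insert x S), insert u I, ?_, (hS.insert_of_adj hs hsx).insert_of_adj (by simp) hxu,
        hPS.trans ((Finset.subset_insert _ _).trans (Finset.subset_insert _ _)),
        Finset.insert_subset_insert _ (hIS.trans (Finset.subset_insert _ _)), ?_, ?_, ?_, ?_⟩
      · exact Finset.insert_subset hu (Finset.insert_subset hx.1 hSC)
      · rw [Finset.card_insert_of_notMem fun h => huS (hIS h), hIn]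
      · have := Finset.card_insert_le u (insert x S)
        have := Finset.card_insert_le x S
        omega
      · intro p hp q hq hpq hadj
        simp only [Finset.coe_insert, Set.mem_insert_iff, Finset.mem_coe] at hp hq
        rcases hp with rfl | hp <;> rcases hq with rfl | hq
        · exact hpq rfl
        · exact hun q (hIS hq) hadj.symm
        · exact hun p (hIS hp) hadj
        · exact hI hp hq hpq hadj
      · intro p hp y hy
        rcases Finset.mem_insert.1 hp with rfl | hp
        · exact fun h => hun y (hPS hy) h.symm
        · exact hIP p hp y hy
  obtain ⟨S, I, -, -, -, -, hIn, -, hI, hIP⟩ := key r le_rfl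
  refine hG.not_indPath5 hP hI hIn.ge fun x hx => ?_
  exact ⟨hIP x hx _ (by simp), hIP x hx _ (by simp), hIP x hx _ (by simp), hIP x hx _ (by simp),
    hIP x hx _ (by simp)⟩

theorem IsCDS.exists_card_le {k r : ℕ} (hG : PathFivePlusFree G r) {C : Finset V}
    (hC : Conn G C) (φ : V → Fin k) (hφ : ∀ u ∈ C, ∀ v ∈ C, G.Adj u v → φ u ≠ φ v) :
    ∃ S, IsCDS G C S ∧ (S.card : ℤ) ≤ max (k : ℤ) (((k : ℤ) + 2) * ((r : ℤ) - 1) + 5) := by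
  by_cases hP : ∀ a ∈ C, ∀ b ∈ C, ∀ c ∈ C, ∀ d ∈ C, ∀ e ∈ C, ¬ IndPath5 G a b c d e
  · obtain ⟨D, hD, hmin⟩ := Finset.exists_min_image (C.powerset.filter fun D => IsCDS G C D)
      Finset.card ⟨C, Finset.mem_filter.2 ⟨by simp, subset_rfl, hC, fun x hx h => absurd hx h⟩⟩
    have hD' : IsMinCDS G C D := ⟨(Finset.mem_filter.1 hD).2, fun D' h =>
      hmin D' (by simp [h, h.1])⟩
    exact ⟨D, hD'.1, le_max_of_le_left (by exact_mod_cast hD'.card_le hP φ hφ)⟩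
  · push Not at hP
    obtain ⟨a, ha, b, hb, c, hc, d, hd, e, he, hP⟩ := hP
    -- For `r = 0` the path alone is already forbidden.
    have hr : 1 ≤ r := by
      by_contra h
      have h0 : r = 0 := by omega
      exact hG.not_indPath5 hP (B := ∅) (by simp [Indep]) (by simp [h0]) (by simp)
    obtain ⟨S, hS, hcard⟩ := IsCDS.exists_of_indPath5 hG hC hP ha hb hc hd he
    refine ⟨S, hS, le_max_of_le_right ?_⟩
    zify at hcard hr
    -- The bound `5 + 2(r - 1)` is weakened by `k(r - 1) ≥ 0`.
    nlinarith [mul_nonneg (Int.natCast_nonneg k) (sub_nonneg.2 hr)]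

/-! ### Components and dominating pairs -/

/-- `C` is the vertex set of a connected component of `G[O]`. -/
def IsComp (G : SimpleGraph V) (O C : Finset V) : Prop :=
  C ⊆ O ∧ Conn G C ∧ ∀ u ∈ C, ∀ v ∈ O, v ∉ C → ¬ G.Adj u v

theorem exists_isComp_eq_supp {O : Finset V} (c : (G.induce (O : Set V)).ConnectedComponent) :
    ∃ C, IsComp G O C ∧ (C : Set V) = Subtype.val '' c.supp := by
  let C := O.filter fun z => ∃ hz : z ∈ (O : Set V), (G.induce (O : Set V)).connectedComponentMk
    ⟨z, hz⟩ = c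
  have hmem : ∀ z : (O : Set V), (z : V) ∈ C ↔
      (G.induce (O : Set V)).connectedComponentMk z = c := fun z =>
    ⟨fun h => (Finset.mem_filter.1 h).2.2, fun h => Finset.mem_filter.2 ⟨z.2, z.2, h⟩⟩
  have hCO : C ⊆ O := Finset.filter_subset _ _
  have hadj : ∀ x y : (O : Set V), (x : V) ∈ C → G.Adj x y → (y : V) ∈ C := by
    intro x y hx hxy
    rw [hmem] at hx ⊢
    rw [← hx]
    exact SimpleGraph.ConnectedComponent.sound
      (SimpleGraph.Adj.reachable (by simpa using hxy.symm))
  refine ⟨C, ⟨hCO, ⟨?_, ?_⟩, ?_⟩, ?_⟩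
  · obtain ⟨x, hx⟩ := c.exists_rep
    exact ⟨x, (hmem x).2 hx⟩
  · intro E hE ⟨a, ha⟩ hne
    obtain ⟨b, hb, hbE⟩ : ∃ b ∈ C, b ∉ E := by
      by_contra! hc
      exact hne (hE.antisymm hc)
    have hr : (G.induce (O : Set V)).Reachable ⟨a, hCO (hE ha)⟩ ⟨b, hCO hb⟩ :=
      SimpleGraph.ConnectedComponent.exact
        (((hmem ⟨a, hCO (hE ha)⟩).1 (hE ha)).trans ((hmem ⟨b, hCO hb⟩).1 hb).symm)
    obtain ⟨p⟩ := hr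
    obtain ⟨d, -, hd1, hd2⟩ := p.exists_boundary_dart {z | (z : V) ∈ E} ha hbE
    have hd : G.Adj d.fst d.snd := by simpa using d.adj
    exact ⟨d.fst, hd1, d.snd, hadj _ _ (hE hd1) hd, hd2, hd⟩
  · intro u hu v hv hvC huv
    exact hvC (hadj ⟨u, hCO hu⟩ ⟨v, hv⟩ hu huv)
  · ext z
    constructor
    · intro hz
      exact ⟨⟨z, hCO hz⟩, (hmem ⟨z, hCO hz⟩).1 hz, rfl⟩
    · rintro ⟨x, hx, rfl⟩
      exact (hmem x).2 hx

/-- If no three vertices of `T` have private neighbours in `X`, then two vertices of `T` dominate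
`N(T) ∩ X`. -/
theorem exists_pair_dominating (T X : Finset V)
    (h : ∀ y : Fin 3 → V, ∀ w : Fin 3 → V, Function.Injective y → (∀ i, y i ∈ T) →
      (∀ i, w i ∈ X) → (∀ i j, G.Adj (y i) (w j) ↔ i = j) → False) :
    ∃ Y ⊆ T, Y.card ≤ 2 ∧ ∀ v ∈ T, ∀ x ∈ X, G.Adj v x → ∃ y ∈ Y, G.Adj y x := by
  obtain ⟨Y, hY, hmin⟩ := Finset.exists_min_image
    (T.powerset.filter fun Y => ∀ v ∈ T, ∀ x ∈ X, G.Adj v x → ∃ y ∈ Y, G.Adj y x) Finset.card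
    ⟨T, by simp only [Finset.mem_filter, Finset.mem_powerset]
           exact ⟨subset_rfl, fun v hv x _ hvx => ⟨v, hv, hvx⟩⟩⟩
  simp only [Finset.mem_filter, Finset.mem_powerset] at hY hmin
  refine ⟨Y, hY.1, ?_, hY.2⟩
  by_contra! hcard
  -- In a smallest dominating `Y`, a vertex without a private neighbour in `X` could be dropped.
  have hpriv : ∀ y ∈ Y, ∃ x ∈ X, ∀ z ∈ Y, G.Adj z x ↔ z = y := by
    intro y hy
    by_contra! hcon
    have := hmin (Y.erase y) ⟨(Finset.erase_subset _ _).trans hY.1, fun v hv x hx hvx => by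
      by_contra! hn
      have huniq : ∀ z ∈ Y, G.Adj z x → z = y := fun z hz hzx => by
        by_contra hzy
        exact hn z (Finset.mem_erase.2 ⟨hzy, hz⟩) hzx
      obtain ⟨z, hz, hzx⟩ := hY.2 v hv x hx hvx
      have hyx : G.Adj y x := huniq z hz hzx ▸ hzx
      obtain ⟨p, hp, hpx⟩ := hcon x hx
      rcases hpx with ⟨h1, h2⟩ | ⟨h1, rfl⟩
      · exact h2 (huniq p hp h1)
      · exact h1 hyx⟩
    rw [Finset.card_erase_of_mem hy] at this
    omega
  obtain ⟨g⟩ : Nonempty (Fin 3 ↪ Y) := Function.Embedding.nonempty_of_card_le (by simpa using Nat.succ_le_of_lt hcard)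
  choose! w hwX hw using hpriv
  refine h (fun i => g i) (fun i => w (g i)) (Subtype.val_injective.comp g.injective)
    (fun i => hY.1 (g i).2) (fun i => hwX _ (g i).2) fun i j => ?_
  rw [hw _ (g j).2 _ (g i).2, Subtype.val_inj, g.injective.eq_iff]

end Graph

section Canvas

open Classical

variable {V : Type*} {k r : ℕ} {G : SimpleGraph V}

theorem listColorable_iff [Nonempty (Fin k)] {L : V → Finset (Fin k)} {T : Finset V} :
    ListColorable G L T ↔ ∃ φ : V → Fin k, (∀ v ∈ T, φ v ∈ L v) ∧
      ∀ u ∈ T, ∀ v ∈ T, G.Adj u v → φ u ≠ φ v := by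
  constructor
  · rintro ⟨φ, hφ⟩
    refine ⟨fun v => if h : v ∈ (T : Set V) then φ ⟨v, h⟩ else Classical.arbitrary _, ?_, ?_⟩
    · intro v hv
      beta_reduce
      rw [dif_pos (Finset.mem_coe.2 hv)]
      exact hφ ⟨v, hv⟩
    · intro u hu v hv huv
      beta_reduce
      rw [dif_pos (Finset.mem_coe.2 hu), dif_pos (Finset.mem_coe.2 hv)]
      exact φ.valid (by simpa using huv)
  · rintro ⟨φ, hL, hφ⟩
    exact ⟨SimpleGraph.Coloring.mk (fun v => φ v.1) fun {u v} huv =>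
      hφ u u.2 v v.2 (by simpa using huv), fun v => hL v v.2⟩

theorem Conn.of_subset {S T : Finset V} (hS : Conn G S) (hST : S ⊆ T)
    (h : ∀ x ∈ T, x ∉ S → ∃ s ∈ S, G.Adj s x) : Conn G T := by
  refine ⟨hS.1.mono hST, fun E hE hne hET => ?_⟩
  by_cases h1 : (E ∩ S).Nonempty
  · by_cases h2 : E ∩ S = S
    · have hSE : S ⊆ E := Finset.inter_eq_right.1 h2
      obtain ⟨b, hb, hbE⟩ : ∃ b ∈ T, b ∉ E := by
        by_contra! hc
        exact hET (hE.antisymm hc)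
      obtain ⟨s, hs, hsb⟩ := h b hb fun hbS => hbE (hSE hbS)
      exact ⟨s, hSE hs, b, hb, hbE, hsb⟩
    · obtain ⟨p, hp, q, hq, hqE, hpq⟩ := hS.2 _ Finset.inter_subset_right h1 h2
      exact ⟨p, (Finset.mem_inter.1 hp).1, q, hST hq,
        fun h => hqE (Finset.mem_inter.2 ⟨h, hq⟩), hpq⟩
  · obtain ⟨y, hy⟩ := hne
    obtain ⟨s, hs, hsy⟩ := h y (hE hy) fun hyS => h1 ⟨y, Finset.mem_inter.2 ⟨hy, hyS⟩⟩
    exact ⟨y, hy, s, hST hs, fun hsE => h1 ⟨s, Finset.mem_inter.2 ⟨hsE, hs⟩⟩, hsy.symm⟩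

/-- Otherwise `y` is more than two steps from `y'` in `S ∪ {y, y'}`. An edge `ab` leaving the set
`D` of vertices reached in one or two steps then gives an induced path `b, a, p, y', w'`. -/
theorem PathFivePlusFree.exists_common_neighbor (hG : PathFivePlusFree G r) {S B : Finset V}
    (hS : Conn G S) (hB : Indep G B) (hr : r ≤ B.card) {y y' w' : V}
    (hy : ∃ s ∈ S, G.Adj s y) (hy' : ∃ s ∈ S, G.Adj s y') (hyy : ¬ G.Adj y y')
    (hw : G.Adj y' w') (hyw : ¬ G.Adj y w') (hSw : ∀ s ∈ S, ¬ G.Adj s w')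
    (hBS : ∀ b ∈ B, ∀ s ∈ S, ¬ G.Adj b s)
    (hBy : ∀ b ∈ B, ¬ G.Adj b y ∧ ¬ G.Adj b y' ∧ ¬ G.Adj b w') :
    ∃ s ∈ S, G.Adj s y ∧ G.Adj s y' := by
  by_contra! hcon
  obtain ⟨s, hs, hsy⟩ := hy
  obtain ⟨s', hs', hsy'⟩ := hy'
  let D := (insert y S).filter fun z =>
    G.Adj y' z ∨ ∃ p ∈ insert y S, G.Adj y' p ∧ G.Adj p z
  have hD : D ≠ insert y S := by
    intro hD
    have hyD : y ∈ D := by rw [hD]; simp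
    rcases (Finset.mem_filter.1 hyD).2 with h | ⟨p, hp, hyp, hpy⟩
    · exact hyy h.symm
    · rcases Finset.mem_insert.1 hp with rfl | hp
      · exact hpy.ne rfl
      · exact hcon p hp hpy hyp.symm
  obtain ⟨a, ha, b, hb, hbD, hab⟩ := (hS.insert_of_adj hs hsy).2 D (Finset.filter_subset _ _)
    ⟨s', by simp [D, hs', hsy'.symm]⟩ hD
  have hins : ∀ z ∈ insert y S, ¬ G.Adj z w' ∧ ∀ x ∈ B, ¬ G.Adj x z := by
    intro z hz
    rcases Finset.mem_insert.1 hz with rfl | hz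
    · exact ⟨hyw, fun x hx => (hBy x hx).1⟩
    · exact ⟨hSw z hz, fun x hx => hBS x hx z hz⟩
  obtain ⟨haS, ha⟩ := Finset.mem_filter.1 ha
  simp only [D, Finset.mem_filter, not_and, not_or, not_exists] at hbD
  obtain ⟨hyb, hbp⟩ := hbD hb
  have hya : ¬ G.Adj y' a := fun h => hbp a haS h hab
  obtain ⟨p, hp, hyp, hpa⟩ := ha.resolve_left hya
  exact hG.not_indPath5 (a := b) (b := a) (c := p) (d := y') (e := w')
    ⟨⟨hab.symm, hpa.symm, hyp.symm, hw⟩, fun h => hbp p hp hyp h.symm, fun h => hyb h.symm,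
      (hins b hb).1, fun h => hya h.symm, (hins a haS).1, (hins p hp).1⟩ hB hr fun x hx =>
      ⟨(hins b hb).2 x hx, (hins a haS).2 x hx, (hins p hp).2 x hx, (hBy x hx).2⟩

/-- If `w 1` and `w 2` are adjacent, the path is `y 0, s, y 1, w 1, w 2`, and the third pair is
needed. If not, it is `w 1, y 1, s, y 2, w 2`. -/
theorem PathFivePlusFree.not_three_private (hG : PathFivePlusFree G r) {S B : Finset V}
    (hB : Indep G B) (hr : r ≤ B.card) {y w : Fin 3 → V}
    (hyw : ∀ i j, G.Adj (y i) (w j) ↔ i = j) (hyy : ∀ i j, ¬ G.Adj (y i) (y j))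
    (hS : ∀ i j, i ≠ j → ∃ s ∈ S, G.Adj s (y i) ∧ G.Adj s (y j))
    (hSw : ∀ s ∈ S, ∀ i, ¬ G.Adj s (w i)) (hBS : ∀ b ∈ B, ∀ s ∈ S, ¬ G.Adj b s)
    (hBy : ∀ b ∈ B, ∀ i, ¬ G.Adj b (y i)) (hBw : ∀ b ∈ B, ∀ i, ¬ G.Adj b (w i)) : False := by
  have hne : ∀ i j, i ≠ j → ¬ G.Adj (y i) (w j) := fun i j hij h => hij ((hyw i j).1 h)
  by_cases hw : G.Adj (w 1) (w 2)
  · obtain ⟨s, hs, hs0, hs1⟩ := hS 0 1 (by decide)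
    exact hG.not_indPath5 (a := y 0) (b := s) (c := y 1) (d := w 1) (e := w 2)
      ⟨⟨hs0.symm, hs1, (hyw 1 1).2 rfl, hw⟩, hyy 0 1, hne 0 1 (by decide), hne 0 2 (by decide),
        hSw s hs 1, hSw s hs 2, hne 1 2 (by decide)⟩ hB hr fun x hx =>
      ⟨hBy x hx 0, hBS x hx s hs, hBy x hx 1, hBw x hx 1, hBw x hx 2⟩
  · obtain ⟨s, hs, hs1, hs2⟩ := hS 1 2 (by decide)
    exact hG.not_indPath5 (a := w 1) (b := y 1) (c := s) (d := y 2) (e := w 2)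
      ⟨⟨((hyw 1 1).2 rfl).symm, hs1.symm, hs2, (hyw 2 2).2 rfl⟩, fun h => hSw s hs 1 h.symm,
        fun h => hne 2 1 (by decide) h.symm, hw, hyy 1 2, hne 1 2 (by decide), hSw s hs 2⟩
      hB hr fun x hx => ⟨hBw x hx 1, hBy x hx 1, hBS x hx s hs, hBy x hx 2, hBw x hx 2⟩

theorem exists_subset_card_le_full (T : Finset V) (r : ℕ) :
    ∃ Z ⊆ T, Z.card ≤ r ∧ (Z.card < r → Z = T) := by
  by_cases h : r ≤ T.card
  · obtain ⟨Z, hZ, hc⟩ := Finset.exists_subset_card_eq h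
    exact ⟨Z, hZ, hc.le, fun h => by omega⟩
  · exact ⟨T, subset_rfl, by omega, fun _ => rfl⟩

/-! ### Sets derived from a tuple, and allowed colours -/

namespace Tuple

variable {Q : Tuple V k}

theorem mem_S {x : V} : x ∈ Q.S ↔ ∃ i, Q.v i = x := by
  simp [S]

theorem v_mem_S (i : Fin Q.t) : Q.v i ∈ Q.S := mem_S.2 ⟨i, rfl⟩

theorem mem_ZAll {c : Fin k} {x : V} : x ∈ Q.ZAll c ↔ ∃ i, x ∈ Q.Z i c := by
  simp [ZAll]

theorem mem_BAll {x : V} : x ∈ Q.BAll ↔ ∃ c, x ∈ Q.B c := by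
  simp [BAll]

end Tuple

variable [Fintype V]

theorem mem_nbr {T : Finset V} {x : V} : x ∈ nbr G T ↔ x ∉ T ∧ ∃ u ∈ T, G.Adj u x := by
  simp [nbr]

theorem mem_nbr₁ {v x : V} : x ∈ nbr₁ G v ↔ G.Adj v x := by
  simp [nbr₁]

namespace Tuple

variable {Q : Tuple V k}

theorem mem_X {i : Fin Q.t} {x : V} :
    x ∈ Q.X G i ↔ x ∉ Q.S ∧ G.Adj (Q.v i) x ∧ ∀ j < i, ¬ G.Adj (Q.v j) x := by
  simp [X]

theorem mem_M {x : V} : x ∈ Q.M G ↔ x ∉ Q.S ∧ ∀ s ∈ Q.S, ¬ G.Adj s x := by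
  simp only [M, Finset.mem_sdiff, Finset.mem_univ, true_and, Finset.mem_union, mem_nbr, not_or,
    not_and, not_exists]
  exact ⟨fun h => ⟨h.1, h.2 h.1⟩, fun h => ⟨h.1, fun _ => h.2⟩⟩

theorem eq_of_mem_X {i j : Fin Q.t} {x : V} (hi : x ∈ Q.X G i) (hj : x ∈ Q.X G j) : i = j := by
  rw [mem_X] at hi hj
  rcases lt_trichotomy i j with h | h | h
  · exact absurd hi.2.1 (hj.2.2 i h)
  · exact h
  · exact absurd hj.2.1 (hi.2.2 j h)

theorem exists_mem_X {x s : V} (hx : x ∉ Q.S) (hs : s ∈ Q.S) (hsx : G.Adj s x) :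
    ∃ i, x ∈ Q.X G i := by
  obtain ⟨i, rfl⟩ := mem_S.1 hs
  obtain ⟨j, hj, hmin⟩ := Finset.exists_min_image
    (Finset.univ.filter fun i => G.Adj (Q.v i) x) id ⟨i, by simpa using hsx⟩
  refine ⟨j, mem_X.2 ⟨hx, by simpa using hj, fun l hl h => ?_⟩⟩
  exact absurd (hmin l (by simpa using h)) (not_le.2 hl)

theorem mem_YAll {c : Fin k} {x : V} : x ∈ Q.YAll c ↔ ∃ i l, i < l ∧ x ∈ Q.Y i c l := by
  simp [YAll]

theorem mem_guess {c : Fin k} {x : V} :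
    x ∈ Q.guess c ↔ x ∈ Q.A c ∨ x ∈ Q.YAll c ∨ x ∈ Q.ZAll c := by
  simp [guess]

theorem mem_newList {L : V → Finset (Fin k)} {i : Fin Q.t} {x : V} (hx : x ∈ Q.X G i)
    {c : Fin k} : c ∈ Q.newList G r L x ↔ c ∈ L x ∧ c ∉ Q.forbidden G r i x := by
  simp only [newList, Finset.mem_filter]
  exact and_congr_right fun _ => ⟨fun h => h i hx, fun h j hj => eq_of_mem_X hx hj ▸ h⟩

theorem Fixed.mem_guess {i : Fin Q.t} {x : V} {c : Fin k} (h : Q.Fixed i x c) :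
    x ∈ Q.guess c := by
  rw [Tuple.mem_guess, mem_YAll, mem_ZAll]
  exact h.imp id (Or.imp (fun ⟨j, hj, hx⟩ => ⟨i, j, hj, hx⟩) id)

/-- What it means for a colour to be allowed at a vertex that is not fixed. -/
structure Allowed (Q : Tuple V k) (G : SimpleGraph V) (r : ℕ) (i : Fin Q.t) (x : V)
    (c : Fin k) : Prop where
  not_fixed : ∀ d, ¬ Q.Fixed i x d
  f_ne : ∀ j, G.Adj x (Q.v j) → Q.f j ≠ c
  mem_nbr_A : ∀ w ∈ Q.M G, w ∉ Q.W G r → G.Adj x w → w ∈ nbr G (Q.A c)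
  not_mem_nbr : x ∉ nbr G (Q.A c ∪ Q.B c ∪ Q.ZAll c ∪ Q.YAll c)
  le_card : r ≤ (Q.Z i c).card
  mem_nbr_Y : ∀ j, i < j → (Q.Z j c).card = r → ∀ w ∈ Q.X G j, G.Adj x w →
    w ∉ nbr G (Q.Z j c) → w ∈ nbr G (Q.Y i c j)

theorem notMem_forbidden {i : Fin Q.t} {x : V} {c : Fin k} :
    c ∉ Q.forbidden G r i x ↔
      ((∃ d, Q.Fixed i x d) ∧ ∀ d, Q.Fixed i x d → c = d) ∨ Q.Allowed G r i x c := by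
  by_cases h : ∃ d, Q.Fixed i x d
  · have : ¬ Q.Allowed G r i x c := fun ha => h.elim ha.not_fixed
    simp [forbidden, h, this]
  · rw [forbidden, if_neg h]
    simp only [h, false_and, false_or, Finset.mem_filter, Finset.mem_univ, true_and, not_or,
      not_exists, not_and, not_not, not_lt]
    constructor
    · rintro ⟨h1, h2, h3, h4, h5⟩
      refine ⟨fun d hd => h ⟨d, hd⟩, h1, ?_, h3, h4, ?_⟩
      · intro w hw hwW hxw
        exact h2 (Finset.mem_inter.2 ⟨mem_nbr₁.2 hxw, Finset.mem_sdiff.2 ⟨hw, hwW⟩⟩)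
      · intro j hj hc w hw hxw hwZ
        exact (Finset.mem_inter.1 (Finset.mem_sdiff.1 (h5 j hj hc (Finset.mem_sdiff.2
          ⟨Finset.mem_inter.2 ⟨mem_nbr₁.2 hxw, hw⟩, hwZ⟩))).1).1
    · rintro ⟨-, h1, h2, h3, h4, h5⟩
      refine ⟨h1, ?_, h3, h4, ?_⟩
      · intro w hw
        obtain ⟨hxw, hw⟩ := Finset.mem_inter.1 hw
        obtain ⟨hw, hwW⟩ := Finset.mem_sdiff.1 hw
        exact h2 w hw hwW (mem_nbr₁.1 hxw)
      · intro j hj hc w hw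
        obtain ⟨hw, hwZ⟩ := Finset.mem_sdiff.1 hw
        obtain ⟨hxw, hw⟩ := Finset.mem_inter.1 hw
        exact Finset.mem_sdiff.2 ⟨Finset.mem_inter.2
          ⟨h5 j hj hc w hw (mem_nbr₁.1 hxw) hwZ, hw⟩, hwZ⟩

/-! ### Canvases read off from a colouring -/

/-- The sets of `Q` are chosen according to the colouring `φ` of `G[O]` and the component `C` of
`G[O]`. -/
structure Guided (Q : Tuple V k) (G : SimpleGraph V) (r : ℕ) (O C : Finset V) (φ : V → Fin k) :
    Prop where
  comp : IsComp G O C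
  cds : IsCDS G C Q.S
  proper : ∀ u ∈ O, ∀ v ∈ O, G.Adj u v → φ u ≠ φ v
  f_eq : ∀ i, Q.f i = φ (Q.v i)
  A_sub : ∀ c, ∀ x ∈ Q.A c, x ∈ C ∧ x ∉ Q.S ∧ φ x = c
  A_card : ∀ c, (Q.A c).card ≤ 2 * k
  A_dom : ∀ x ∈ C, x ∉ Q.S → ∀ w ∈ Q.M G, w ∉ Q.W G r → G.Adj x w → w ∈ nbr G (Q.A (φ x))
  B_sub : ∀ c, ∀ x ∈ Q.B c, x ∈ O ∧ x ∉ C ∧ φ x = c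
  B_card : ∀ c, (Q.B c).card ≤ r
  B_full : ∀ c, (Q.B c).card < r → ∀ x ∈ O, x ∉ C → φ x = c → x ∈ Q.B c
  Y_sub : ∀ i c l, ∀ x ∈ Q.Y i c l, x ∈ C ∧ x ∈ Q.X G i ∧ φ x = c
  Y_card : ∀ i c l, (Q.Y i c l).card ≤ 2
  Y_dom : ∀ i l, i < l → ∀ x ∈ C, x ∈ Q.X G i → (Q.Z l (φ x)).card = r → ∀ w ∈ Q.X G l,
    G.Adj x w → w ∉ nbr G (Q.Z l (φ x)) → w ∈ nbr G (Q.Y i (φ x) l)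
  Z_sub : ∀ i c, ∀ x ∈ Q.Z i c, x ∈ C ∧ x ∈ Q.X G i ∧ φ x = c
  Z_card : ∀ i c, (Q.Z i c).card ≤ r
  Z_full : ∀ i c, (Q.Z i c).card < r → ∀ x ∈ C, x ∈ Q.X G i → φ x = c → x ∈ Q.Z i c

namespace Guided

variable {O C : Finset V} {φ : V → Fin k} {L : V → Finset (Fin k)}

theorem guess_sub (h : Q.Guided G r O C φ) {c : Fin k} {x : V} (hx : x ∈ Q.guess c) :
    x ∈ C ∧ x ∉ Q.S ∧ φ x = c := by
  rw [mem_guess, mem_YAll, mem_ZAll] at hx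
  rcases hx with hx | ⟨i, l, -, hx⟩ | ⟨i, hx⟩
  · exact h.A_sub c x hx
  · have := h.Y_sub _ _ _ _ hx
    exact ⟨this.1, (mem_X.1 this.2.1).1, this.2.2⟩
  · have := h.Z_sub _ _ _ hx
    exact ⟨this.1, (mem_X.1 this.2.1).1, this.2.2⟩

theorem mem_M (h : Q.Guided G r O C φ) {x : V} (hxO : x ∈ O) (hxC : x ∉ C) : x ∈ Q.M G :=
  Tuple.mem_M.2 ⟨fun hxS => hxC (h.cds.1 hxS),
    fun s hs hsx => h.comp.2.2 s (h.cds.1 hs) x hxO hxC hsx⟩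

theorem exists_mem_X (h : Q.Guided G r O C φ) {x : V} (hx : x ∈ C) (hxS : x ∉ Q.S) :
    ∃ i, x ∈ Q.X G i := by
  obtain ⟨s, hs, hsx⟩ := h.cds.2.2 x hx hxS
  exact Tuple.exists_mem_X hxS hs hsx

theorem indep (h : Q.Guided G r O C φ) {T : Finset V} {c : Fin k}
    (hT : ∀ x ∈ T, x ∈ O ∧ φ x = c) : Indep G T := fun x hx y hy _ hxy =>
  h.proper x (hT x hx).1 y (hT y hy).1 hxy ((hT x hx).2.trans (hT y hy).2.symm)

theorem notMem_nbr_BAll (h : Q.Guided G r O C φ) {x : V} (hx : x ∈ C) : x ∉ nbr G Q.BAll := by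
  rw [mem_nbr]
  rintro ⟨-, b, hb, hbx⟩
  obtain ⟨c, hb⟩ := mem_BAll.1 hb
  have := h.B_sub c b hb
  exact h.comp.2.2 x hx b this.1 this.2.1 hbx.symm

theorem isCanvas (h : Q.Guided G r O C φ) (hL : ∀ x ∈ O, φ x ∈ L x)
    (hcard : (Q.S.card : ℤ) ≤ max (k : ℤ) (((k : ℤ) + 2) * ((r : ℤ) - 1) + 5)) :
    Q.IsCanvas G r L := by
  have hCO := h.comp.1
  have hSO : ∀ i, Q.v i ∈ O := fun i => hCO (h.cds.1 (v_mem_S i))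
  have hA : ∀ c, ∀ x ∈ Q.A c, x ∈ O ∧ φ x = c := fun c x hx =>
    ⟨hCO (h.A_sub c x hx).1, (h.A_sub c x hx).2.2⟩
  have hB : ∀ c, ∀ x ∈ Q.B c, x ∈ O ∧ φ x = c := fun c x hx =>
    ⟨(h.B_sub c x hx).1, (h.B_sub c x hx).2.2⟩
  have hY : ∀ i c l, ∀ x ∈ Q.Y i c l, x ∈ O ∧ φ x = c := fun i c l x hx =>
    ⟨hCO (h.Y_sub i c l x hx).1, (h.Y_sub i c l x hx).2.2⟩
  have hZ : ∀ i c, ∀ x ∈ Q.Z i c, x ∈ O ∧ φ x = c := fun i c x hx =>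
    ⟨hCO (h.Z_sub i c x hx).1, (h.Z_sub i c x hx).2.2⟩
  have hlist : ∀ {x : V} {c : Fin k}, x ∈ O ∧ φ x = c → c ∈ L x := fun hx => hx.2 ▸ hL _ hx.1
  have hdisj : ∀ {T T' : Finset V} {c d : Fin k}, c ≠ d → (∀ x ∈ T, x ∈ O ∧ φ x = c) →
      (∀ x ∈ T', x ∈ O ∧ φ x = d) → Disjoint T T' := fun hcd h1 h2 =>
    Finset.disjoint_left.2 fun x hx hx' => hcd ((h1 x hx).2.symm.trans (h2 x hx').2)
  exact
    { card_S := by simpa [S] using hcard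
      connected_S := h.cds.2.1.connected
      f_list := fun i => h.f_eq i ▸ hL _ (hSO i)
      f_proper := fun i j hij => by
        rw [h.f_eq, h.f_eq]
        exact h.proper _ (hSO i) _ (hSO j) hij
      A_sub := fun c x hx => mem_nbr.2
        ⟨(h.A_sub c x hx).2.1, h.cds.2.2 x (h.A_sub c x hx).1 (h.A_sub c x hx).2.1⟩
      A_indep := fun c => h.indep (hA c)
      A_card := h.A_card
      A_list := fun c x hx => hlist (hA c x hx)
      B_sub := fun c x hx => h.mem_M (h.B_sub c x hx).1 (h.B_sub c x hx).2.1
      B_indep := fun c => h.indep (hB c)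
      B_card := h.B_card
      B_list := fun c x hx => hlist (hB c x hx)
      Y_sub := fun i c l _ x hx => (h.Y_sub i c l x hx).2.1
      Y_indep := fun i c l _ => h.indep (hY i c l)
      Y_card := fun i c l _ => h.Y_card i c l
      Y_list := fun i c l _ x hx => hlist (hY i c l x hx)
      Z_sub := fun i c x hx => (h.Z_sub i c x hx).2.1
      Z_indep := fun i c => h.indep (hZ i c)
      Z_card := h.Z_card
      Z_list := fun i c x hx => hlist (hZ i c x hx)
      small_Z_Y := fun i c hc l _ x hx => by
        have := h.Y_sub i c l x hx
        exact h.Z_full i c hc x this.1 this.2.1 this.2.2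
      small_Z_A := fun i c hc x hx => by
        obtain ⟨hxA, hxX⟩ := Finset.mem_inter.1 hx
        exact h.Z_full i c hc x (h.A_sub c x hxA).1 hxX (h.A_sub c x hxA).2.2
      disj_A := fun c d hcd => hdisj hcd (hA c) (hA d)
      disj_B := fun c d hcd => hdisj hcd (hB c) (hB d)
      disj_Z := fun i c d hcd => hdisj hcd (hZ i c) (hZ i d)
      disj_Y := fun i c d l m hcd _ _ => hdisj hcd (hY i c l) (hY i d m)
      disj_A_Y := fun i c d l hcd _ => hdisj hcd (hA c) (hY i d l)
      disj_A_Z := fun i c d hcd => hdisj hcd (hA c) (hZ i d)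
      disj_Y_Z := fun i c d l hcd _ => hdisj hcd (hY i c l) (hZ i d)
      colour := fun c => h.indep (c := c) fun x hx => by
        rcases Finset.mem_union.1 hx with hx | hx
        · simp only [Finset.mem_map, Finset.mem_filter, Finset.mem_univ, true_and] at hx
          obtain ⟨i, hi, rfl⟩ := hx
          exact ⟨hSO i, h.f_eq i ▸ hi⟩
        · exact ⟨hCO (h.guess_sub hx).1, (h.guess_sub hx).2.2⟩
      comps := by
        have key : ∀ b ∈ Q.BAll, b ∈ O ∧ b ∉ C := fun b hb => by
          obtain ⟨c, hb⟩ := mem_BAll.1 hb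
          exact ⟨(h.B_sub c b hb).1, (h.B_sub c b hb).2.1⟩
        have key' : ∀ x ∈ Finset.univ.biUnion Q.guess, x ∈ C := fun x hx => by
          obtain ⟨c, -, hx⟩ := Finset.mem_biUnion.1 hx
          exact (h.guess_sub hx).1
        exact ⟨Finset.disjoint_left.2 fun x hx hx' => (key x hx).2 (key' x hx'),
          fun u hu v hv huv => h.comp.2.2 v (key' v hv) u (key u hu).1 (key u hu).2 huv.symm⟩ }

theorem fixed_or_allowed (h : Q.Guided G r O C φ) {i : Fin Q.t} {x : V} (hx : x ∈ Q.X G i)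
    {c : Fin k} (hc : c ∈ Q.newList G r L x) :
    (Q.Fixed i x c ∧ x ∈ C ∧ φ x = c) ∨ Q.Allowed G r i x c := by
  rcases notMem_forbidden.1 ((mem_newList hx).1 hc).2 with ⟨⟨d, hd⟩, hf⟩ | ha
  · obtain rfl := hf d hd
    have := h.guess_sub hd.mem_guess
    exact Or.inl ⟨hd, this.1, this.2.2⟩
  · exact Or.inr ha

/-- This makes `C ∩ X_i` a feasible competitor for the solver. No rule can forbid `φ x`, because
every guessed set consists of vertices of `O` in their `φ`-colours. -/
theorem mem_newList (h : Q.Guided G r O C φ) (hL : ∀ x ∈ O, φ x ∈ L x) {i : Fin Q.t} {x : V}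
    (hxC : x ∈ C) (hx : x ∈ Q.X G i) : φ x ∈ Q.newList G r L x := by
  have hCO := h.comp.1
  rw [Tuple.mem_newList hx, notMem_forbidden]
  refine ⟨hL x (hCO hxC), ?_⟩
  by_cases hf : ∃ d, Q.Fixed i x d
  · exact Or.inl ⟨hf, fun d hd => (h.guess_sub hd.mem_guess).2.2⟩
  · have hxS := (mem_X.1 hx).1
    push Not at hf
    refine Or.inr ⟨hf, ?_, ?_, ?_, ?_, ?_⟩
    · intro j hj
      rw [h.f_eq]
      exact h.proper _ (hCO (h.cds.1 (v_mem_S j))) _ (hCO hxC) hj.symm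
    · exact h.A_dom x hxC hxS
    · rw [mem_nbr]
      rintro ⟨-, u, hu, hux⟩
      simp only [Finset.mem_union] at hu
      by_cases hB : u ∈ Q.B (φ x)
      · have := h.B_sub _ _ hB
        exact h.proper u this.1 x (hCO hxC) hux this.2.2
      · have hu' : u ∈ Q.guess (φ x) := by rw [mem_guess]; tauto
        have := h.guess_sub hu'
        exact h.proper u (hCO this.1) x (hCO hxC) hux this.2.2
    · by_contra hlt
      exact hf (φ x) (Or.inr (Or.inr ⟨i, h.Z_full i _ (not_le.1 hlt) x hxC hx rfl⟩))
    · exact fun j hj hc => h.Y_dom i j hj x hxC hx hc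

theorem f_ne_of_mem_newList (h : Q.Guided G r O C φ) {i : Fin Q.t} {x : V} (hx : x ∈ Q.X G i)
    {c : Fin k} (hc : c ∈ Q.newList G r L x) {j : Fin Q.t} (hj : G.Adj (Q.v j) x) :
    Q.f j ≠ c := by
  rcases h.fixed_or_allowed hx hc with ⟨-, hxC, rfl⟩ | ha
  · rw [h.f_eq]
    exact h.proper _ (h.comp.1 (h.cds.1 (v_mem_S j))) _ (h.comp.1 hxC) hj
  · exact ha.f_ne j hj.symm

/-- All of `X_i` is adjacent to `v_i`, so the colour of `v_i` is missing. -/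
theorem card_newList_lt (h : Q.Guided G r O C φ) (i : Fin Q.t) {T : Finset V}
    (hT : T ⊆ Q.X G i) : (T.biUnion (Q.newList G r L)).card < k := by
  have : T.biUnion (Q.newList G r L) ⊂ Finset.univ := by
    refine Finset.ssubset_univ_iff.2 fun huniv => ?_
    have hm : Q.f i ∈ T.biUnion (Q.newList G r L) := by rw [huniv]; simp
    obtain ⟨x, hx, hc⟩ := Finset.mem_biUnion.1 hm
    exact h.f_ne_of_mem_newList (hT hx) hc (mem_X.1 (hT hx)).2.1 rfl
  simpa using Finset.card_lt_card this

/-- Since `nbr` excludes the set itself, `x` must first be seen to lie outside the guessed sets: it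
is not fixed, and `B_c` lies in `M`. -/
theorem not_adj_guess {i : Fin Q.t} {x : V} (h : Q.Guided G r O C φ) (hx : x ∈ Q.X G i)
    {c : Fin k} (ha : Q.Allowed G r i x c) : ∀ u ∈ Q.guess c, ¬ G.Adj u x := by
  intro u hu hux
  refine ha.not_mem_nbr (mem_nbr.2 ⟨fun hxm => ?_, u, ?_, hux⟩)
  · simp only [Finset.mem_union] at hxm
    rcases hxm with ((hxm | hxm) | hxm) | hxm
    · exact ha.not_fixed c (Or.inl hxm)
    · have hm := h.mem_M (h.B_sub _ _ hxm).1 (h.B_sub _ _ hxm).2.1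
      exact (Tuple.mem_M.1 hm).2 _ (v_mem_S i) (mem_X.1 hx).2.1
    · exact ha.not_fixed c (Or.inr (Or.inr (mem_ZAll.1 hxm)))
    · obtain ⟨p, l, hpl, hxY⟩ := mem_YAll.1 hxm
      obtain rfl := eq_of_mem_X hx (h.Y_sub _ _ _ _ hxY).2.1
      exact ha.not_fixed c (Or.inr (Or.inl ⟨l, hpl, hxY⟩))
  · rw [mem_guess] at hu
    simp only [Finset.mem_union]
    tauto

theorem not_adj_of_lt (h : Q.Guided G r O C φ) {i j : Fin Q.t} (hij : i < j) {x w : V}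
    (hx : x ∈ Q.X G i) (hw : w ∈ Q.X G j) {c : Fin k} (hcx : c ∈ Q.newList G r L x)
    (hcw : c ∈ Q.newList G r L w) : ¬ G.Adj x w := by
  intro hxw
  rcases h.fixed_or_allowed hx hcx with ⟨hxf, hxC, hxc⟩ | hxa
  · rcases h.fixed_or_allowed hw hcw with ⟨-, hwC, hwc⟩ | hwa
    · exact h.proper x (h.comp.1 hxC) w (h.comp.1 hwC) hxw (hxc.trans hwc.symm)
    · exact h.not_adj_guess hw hwa x hxf.mem_guess hxw
  · rcases h.fixed_or_allowed hw hcw with ⟨hwf, -, -⟩ | hwa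
    · exact h.not_adj_guess hx hxa w hwf.mem_guess hxw.symm
    · have hng := h.not_adj_guess hw hwa
      have hZ : w ∉ nbr G (Q.Z j c) := by
        rw [mem_nbr]
        rintro ⟨-, u, hu, huw⟩
        exact hng u (Tuple.mem_guess.2 (Or.inr (Or.inr (mem_ZAll.2 ⟨j, hu⟩)))) huw
      obtain ⟨-, y, hy, hyw⟩ := mem_nbr.1 (hxa.mem_nbr_Y j hij
        (le_antisymm (h.Z_card j c) hwa.le_card) w hw hxw hZ)
      exact hng y (Tuple.mem_guess.2 (Or.inr (Or.inl (mem_YAll.2 ⟨i, j, hij, hy⟩)))) hyw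

/-- Let `y` be a neighbour of `x` in `O \ C`, with `x` not fixed. If `y ∈ W`, either `B_{φ y}` is
full and `y` has a neighbour of its own colour, or `y` itself lies in `B_{φ y}` and `x` was removed.
If `y ∉ W`, then `y` has a neighbour in `A_c ⊆ C`. -/
theorem not_adj_outside (h : Q.Guided G r O C φ) {i : Fin Q.t} {x : V} (hx : x ∈ Q.X G i)
    (hxB : x ∉ nbr G Q.BAll) {c : Fin k} (hc : c ∈ Q.newList G r L x) {y : V} (hy : y ∈ O)
    (hyC : y ∉ C) : ¬ G.Adj x y := by
  intro hxy
  have hyM := h.mem_M hy hyC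
  rcases h.fixed_or_allowed hx hc with ⟨-, hxC, -⟩ | ha
  · exact h.comp.2.2 x hxC y hy hyC hxy
  · by_cases hyW : y ∈ Q.W G r
    · by_cases hcard : (Q.B (φ y)).card = r
      · obtain ⟨z, hz⟩ := (Finset.mem_filter.1 hyW).2 (φ y) hcard
        obtain ⟨hyz, hz⟩ := Finset.mem_inter.1 hz
        have := h.B_sub _ _ hz
        exact h.proper y hy z this.1 (mem_nbr₁.1 hyz) this.2.2.symm
      · have hyB := h.B_full (φ y) (lt_of_le_of_ne (h.B_card _) hcard) y hy hyC rfl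
        refine hxB (mem_nbr.2 ⟨fun hxB => ?_, y, mem_BAll.2 ⟨_, hyB⟩, hxy.symm⟩)
        obtain ⟨d, hxB⟩ := mem_BAll.1 hxB
        have hm := h.mem_M (h.B_sub _ _ hxB).1 (h.B_sub _ _ hxB).2.1
        exact (Tuple.mem_M.1 hm).2 _ (v_mem_S i) (mem_X.1 hx).2.1
    · obtain ⟨-, a, ha, hay⟩ := mem_nbr.1 (ha.mem_nbr_A y hyM hyW hxy)
      exact h.comp.2.2 a (h.A_sub _ _ ha).1 y hy hyC hay

theorem exchange (h : Q.Guided G r O C φ) {ω : V → ℝ≥0}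
    {U : Finset V → (V → Finset (Fin k)) → Finset V} (hU : IsSolver G ω U)
    (hL : ∀ x ∈ O, φ x ∈ L x) (hO : IsOptimum G ω L Finset.univ O) :
    IsOptimum G ω L Finset.univ ((O \ C) ∪ Q.output G r L U) ∧
      IsComp G ((O \ C) ∪ Q.output G r L U) (Q.output G r L U) ∧
      Disjoint (O \ C) (Q.output G r L U) := by
  have hCO := h.comp.1
  obtain ⟨s₀, hs₀⟩ := h.cds.2.1.1
  have : Nonempty (Fin k) := ⟨φ s₀⟩
  let R : Fin Q.t → Finset V := fun i => Q.X G i \ nbr G Q.BAll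
  let T : Fin Q.t → Finset V := fun i => U (R i) (Q.newList G r L)
  have hT : ∀ i, IsOptimum G ω (Q.newList G r L) (R i) (T i) := fun i =>
    hU _ _ (h.card_newList_lt i Finset.sdiff_subset)
  have hTX : ∀ i, ∀ x ∈ T i, x ∈ Q.X G i ∧ x ∉ nbr G Q.BAll := fun i x hx =>
    Finset.mem_sdiff.1 ((hT i).1 hx)
  choose ψ hψL hψ using fun i => listColorable_iff.1 (hT i).2.1
  have hout : ∀ x, x ∈ Q.output G r L U ↔ x ∈ Q.S ∨ ∃ i, x ∈ T i := fun x => by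
    simp [output, T, R]
  have hanti : ∀ x ∈ Q.output G r L U, ∀ y ∈ O, y ∉ C → ¬ G.Adj x y := by
    intro x hx y hy hyC
    rcases (hout x).1 hx with hx | ⟨i, hx⟩
    · exact h.comp.2.2 x (h.cds.1 hx) y hy hyC
    · exact h.not_adj_outside (hTX i x hx).1 (hTX i x hx).2 (hψL i x hx) hy hyC
  have hdisj : Disjoint (O \ C) (Q.output G r L U) := by
    refine Finset.disjoint_left.2 fun x hx hx' => ?_
    obtain ⟨hxO, hxC⟩ := Finset.mem_sdiff.1 hx
    have hM := Tuple.mem_M.1 (h.mem_M hxO hxC)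
    rcases (hout x).1 hx' with hx' | ⟨i, hx'⟩
    · exact hM.1 hx'
    · exact hM.2 _ (v_mem_S i) (mem_X.1 (hTX i x hx').1).2.1
  refine ⟨⟨Finset.subset_univ _, ?_, ?_⟩, ⟨Finset.subset_union_right, ?_, ?_⟩, hdisj⟩
  · let χ : V → Fin k := fun x => if h : ∃ i, x ∈ Q.X G i then ψ h.choose x else φ x
    have hχX : ∀ i, ∀ x ∈ Q.X G i, χ x = ψ i x := fun i x hx => by
      have hex : ∃ i, x ∈ Q.X G i := ⟨i, hx⟩
      simp only [χ, dif_pos hex]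
      rw [eq_of_mem_X hex.choose_spec hx]
    have hχφ : ∀ x, (∀ i, x ∉ Q.X G i) → χ x = φ x := fun x hx => by
      simp only [χ, dif_neg (not_exists.2 hx)]
    have hcases : ∀ x ∈ (O \ C) ∪ Q.output G r L U,
        (x ∈ O ∧ χ x = φ x) ∨ ∃ i, x ∈ T i ∧ χ x = ψ i x := by
      intro x hx
      rcases Finset.mem_union.1 hx with hx | hx
      · obtain ⟨hxO, hxC⟩ := Finset.mem_sdiff.1 hx
        exact Or.inl ⟨hxO, hχφ x fun i hi => (Tuple.mem_M.1 (h.mem_M hxO hxC)).2 _ (v_mem_S i)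
          (mem_X.1 hi).2.1⟩
      · rcases (hout x).1 hx with hx | ⟨i, hx⟩
        · exact Or.inl ⟨hCO (h.cds.1 hx), hχφ x fun i hi => (mem_X.1 hi).1 hx⟩
        · exact Or.inr ⟨i, hx, hχX i x (hTX i x hx).1⟩
    have hmixed : ∀ x ∈ (O \ C) ∪ Q.output G r L U, χ x = φ x → ∀ i, ∀ y ∈ T i,
        (∀ i, x ∉ T i) → G.Adj x y → φ x ≠ ψ i y := by
      intro x hx hxφ i y hy hxT hxy
      have hyo : y ∈ Q.output G r L U := (hout y).2 (Or.inr ⟨i, hy⟩)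
      rcases Finset.mem_union.1 hx with hx | hx
      · obtain ⟨hxO, hxC⟩ := Finset.mem_sdiff.1 hx
        exact absurd hxy.symm (hanti y hyo x hxO hxC)
      · rcases (hout x).1 hx with hx | ⟨j, hx⟩
        · obtain ⟨j, rfl⟩ := mem_S.1 hx
          rw [← h.f_eq]
          exact h.f_ne_of_mem_newList (hTX i y hy).1 (hψL i y hy) hxy
        · exact absurd hx (hxT j)
    refine listColorable_iff.2 ⟨χ, ?_, ?_⟩
    · intro x hx
      rcases hcases x hx with ⟨hxO, hx⟩ | ⟨i, hxT, hx⟩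
      · rw [hx]
        exact hL x hxO
      · rw [hx]
        exact ((Tuple.mem_newList (hTX i x hxT).1).1 (hψL i x hxT)).1
    · intro x hx y hy hxy
      by_cases hxT : ∃ i, x ∈ T i
      · obtain ⟨i, hxi⟩ := hxT
        have hxX := (hTX i x hxi).1
        rw [hχX i x hxX]
        by_cases hyT : ∃ j, y ∈ T j
        · obtain ⟨j, hyj⟩ := hyT
          have hyX := (hTX j y hyj).1
          rw [hχX j y hyX]
          have hxl := hψL i x hxi
          have hyl := hψL j y hyj
          rcases lt_trichotomy i j with hij | rfl | hij
          · intro he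
            rw [← he] at hyl
            exact h.not_adj_of_lt hij hxX hyX hxl hyl hxy
          · exact hψ i x hxi y hyj hxy
          · intro he
            rw [← he] at hyl
            exact h.not_adj_of_lt hij hyX hxX hyl hxl hxy.symm
        · push Not at hyT
          rcases hcases y hy with ⟨-, hyφ⟩ | ⟨j, hj, -⟩
          · rw [hyφ]
            exact (hmixed y hy hyφ i x hxi hyT hxy.symm).symm
          · exact absurd hj (hyT j)
      · push Not at hxT
        rcases hcases x hx with ⟨hxO, hxφ⟩ | ⟨j, hj, -⟩
        · rcases hcases y hy with ⟨hyO, hyφ⟩ | ⟨i, hyi, hyψ⟩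
          · rw [hxφ, hyφ]
            exact h.proper x hxO y hyO hxy
          · rw [hxφ, hyψ]
            exact hmixed x hx hxφ i y hyi hxT hxy
        · exact absurd hj (hxT j)
  · intro T' hT' hT'c
    refine (hO.2.2 T' hT' hT'c).trans ?_
    -- Both `C` and the output split into `S` and parts inside the disjoint `X_i`, so weights are
    -- compared part by part.
    have hC : C = Q.S ∪ Finset.univ.biUnion fun i => C ∩ Q.X G i := by
      ext x
      simp only [Finset.mem_union, Finset.mem_biUnion, Finset.mem_univ, true_and,
        Finset.mem_inter]
      constructor
      · intro hx
        by_cases hxS : x ∈ Q.S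
        · exact Or.inl hxS
        · obtain ⟨i, hi⟩ := h.exists_mem_X hx hxS
          exact Or.inr ⟨i, hx, hi⟩
      · rintro (hx | ⟨i, hx, -⟩)
        · exact h.cds.1 hx
        · exact hx
    have hsum : ∀ P : Fin Q.t → Finset V, (∀ i, P i ⊆ Q.X G i) →
        ∑ v ∈ Q.S ∪ Finset.univ.biUnion P, ω v = ∑ v ∈ Q.S, ω v + ∑ i, ∑ v ∈ P i, ω v := by
      intro P hP
      rw [Finset.sum_union, Finset.sum_biUnion]
      · intro i _ j _ hij
        exact Finset.disjoint_left.2 fun x hx hx' => hij (eq_of_mem_X (hP i hx) (hP j hx'))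
      · refine Finset.disjoint_left.2 fun x hx hx' => ?_
        obtain ⟨i, -, hx'⟩ := Finset.mem_biUnion.1 hx'
        exact (mem_X.1 (hP i hx')).1 hx
    rw [Finset.sum_union hdisj, ← Finset.sum_sdiff hCO]
    refine add_le_add le_rfl ?_
    have hCsum := hsum (fun i => C ∩ Q.X G i) fun i => Finset.inter_subset_right
    have hTsum := hsum T fun i x hx => (hTX i x hx).1
    rw [← hC] at hCsum
    rw [hCsum, show Q.output G r L U = Q.S ∪ Finset.univ.biUnion T from rfl, hTsum]
    refine add_le_add le_rfl (Finset.sum_le_sum fun i _ => (hT i).2.2 _ ?_ ?_)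
    · intro x hx
      obtain ⟨hxC, hxX⟩ := Finset.mem_inter.1 hx
      exact Finset.mem_sdiff.2 ⟨hxX, h.notMem_nbr_BAll hxC⟩
    · refine listColorable_iff.2 ⟨φ, fun x hx => ?_, fun x hx y hy => ?_⟩
      · obtain ⟨hxC, hxX⟩ := Finset.mem_inter.1 hx
        exact h.mem_newList hL hxC hxX
      · exact h.proper x (hCO (Finset.mem_inter.1 hx).1) y (hCO (Finset.mem_inter.1 hy).1)
  · refine h.cds.2.1.of_subset (fun x hx => (hout x).2 (Or.inl hx)) fun x hx hxS => ?_
    obtain ⟨i, hi⟩ := ((hout x).1 hx).resolve_left hxS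
    exact ⟨_, v_mem_S i, (mem_X.1 (hTX i x hi).1).2.1⟩
  · intro x hx y hy hyo
    obtain ⟨hyO, hyC⟩ := Finset.mem_sdiff.1 ((Finset.mem_union.1 hy).resolve_right hyo)
    exact hanti x hx y hyO hyC

end Guided

/-! ### Construction of the canvas -/

theorem exists_guided (hG : PathFivePlusFree G r) {O C S : Finset V} {φ : V → Fin k}
    (hC : IsComp G O C) (hφ : ∀ u ∈ O, ∀ v ∈ O, G.Adj u v → φ u ≠ φ v) (hS : IsCDS G C S) :
    ∃ Q : Tuple V k, Q.S = S ∧ Q.Guided G r O C φ := by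
  have hCO := hC.1
  let v : Fin S.card ↪ V := S.equivFin.symm.toEmbedding.trans (Function.Embedding.subtype _)
  -- `X` and `M` depend only on the ordered set `S`, so empty guesses suffice to define them.
  let Q₀ : Tuple V k := ⟨S.card, v, fun i => φ (v i), fun _ => ∅, fun _ => ∅,
    fun _ _ _ => ∅, fun _ _ => ∅⟩
  have hQS : Q₀.S = S := by
    ext x
    rw [mem_S]
    constructor
    · rintro ⟨i, rfl⟩
      exact (S.equivFin.symm i).2
    · intro hx
      exact ⟨S.equivFin ⟨x, hx⟩, by simp [Q₀, v]⟩
  choose B hBsub hBcard hBfull using fun c : Fin k =>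
    exists_subset_card_le_full ((O \ C).filter fun x => φ x = c) r
  choose Z hZsub hZcard hZfull using fun (i : Fin S.card) (c : Fin k) =>
    exists_subset_card_le_full ((C ∩ Q₀.X G i).filter fun x => φ x = c) r
  have hB : ∀ c, ∀ x ∈ B c, x ∈ O ∧ x ∉ C ∧ φ x = c := fun c x hx => by
    simpa [and_assoc] using hBsub c hx
  have hZ : ∀ i c, ∀ x ∈ Z i c, x ∈ C ∧ x ∈ Q₀.X G i ∧ φ x = c := fun i c x hx => by
    simpa [and_assoc] using hZsub i c hx
  have hindep : ∀ (T : Finset V) (c : Fin k), (∀ x ∈ T, x ∈ O ∧ φ x = c) → Indep G T :=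
    fun T c hT x hx y hy _ hxy => hφ x (hT x hx).1 y (hT y hy).1 hxy
      ((hT x hx).2.trans (hT y hy).2.symm)
  have hYex : ∀ (i : Fin S.card) (c : Fin k) (l : Fin S.card),
      ∃ Y ⊆ (C ∩ Q₀.X G i).filter fun x => φ x = c, Y.card ≤ 2 ∧
        (i < l → (Z l c).card = r → ∀ x ∈ (C ∩ Q₀.X G i).filter fun x => φ x = c,
          ∀ w ∈ Q₀.X G l \ nbr G (Z l c), G.Adj x w → ∃ y ∈ Y, G.Adj y w) := by
    intro i c l
    by_cases hil : i < l ∧ (Z l c).card = r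
    · obtain ⟨Y, hY, hYc, hYd⟩ := exists_pair_dominating
        ((C ∩ Q₀.X G i).filter fun x => φ x = c) (Q₀.X G l \ nbr G (Z l c)) (by
          intro y w _ hy hw hyw
          simp only [Finset.mem_filter, Finset.mem_inter] at hy
          simp only [Finset.mem_sdiff] at hw
          -- All `y` share the neighbour `v_i`, which sees nothing in `X_l` because `i < l`. The
          -- full set `Z_{l,c}` supplies the isolated vertices.
          refine hG.not_three_private (S := {v i}) (B := Z l c)
            (hindep _ c fun x hx => ⟨hCO (hZ l c x hx).1, (hZ l c x hx).2.2⟩) hil.2.ge hyw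
            ?_ ?_ ?_ ?_ ?_ ?_
          · exact fun p q hpq => hφ _ (hCO (hy p).1.1) _ (hCO (hy q).1.1) hpq
              ((hy p).2.trans (hy q).2.symm)
          · exact fun p q _ => ⟨v i, by simp, (mem_X.1 (hy p).1.2).2.1, (mem_X.1 (hy q).1.2).2.1⟩
          · intro s hs p
            rw [Finset.mem_singleton.1 hs]
            exact (mem_X.1 (hw p).1).2.2 i hil.1
          · intro b hb s hs
            rw [Finset.mem_singleton.1 hs]
            exact fun h => (mem_X.1 (hZ l c b hb).2.1).2.2 i hil.1 h.symm
          · exact fun b hb p hbp => hφ _ (hCO (hZ l c b hb).1) _ (hCO (hy p).1.1) hbp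
              ((hZ l c b hb).2.2.trans (hy p).2.symm)
          · intro b hb p hbp
            refine (hw p).2 (mem_nbr.2 ⟨fun hwZ => ?_, b, hb, hbp⟩)
            have := hZ l c _ hwZ
            exact hφ _ (hCO (hZ l c b hb).1) _ (hCO this.1) hbp
              ((hZ l c b hb).2.2.trans this.2.2.symm))
      exact ⟨Y, hY, hYc, fun _ _ => hYd⟩
    · exact ⟨∅, by simp, by simp, fun h1 h2 => absurd ⟨h1, h2⟩ hil⟩
  choose Y hYsub hYcard hYdom using hYex
  -- One pair for each full `B_d`; their union over `d` gives the bound `2k` on `A_c`.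
  have hAex : ∀ c d : Fin k, ∃ A ⊆ (C \ S).filter fun x => φ x = c, A.card ≤ 2 ∧
      ((B d).card = r → ∀ x ∈ (C \ S).filter fun x => φ x = c,
        ∀ w ∈ (Q₀.M G).filter fun w => ∀ b ∈ B d, ¬ G.Adj b w,
          G.Adj x w → ∃ y ∈ A, G.Adj y w) := by
    intro c d
    by_cases hd : (B d).card = r
    · obtain ⟨A, hA, hAc, hAd⟩ := exists_pair_dominating
        ((C \ S).filter fun x => φ x = c) ((Q₀.M G).filter fun w => ∀ b ∈ B d, ¬ G.Adj b w) (by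
          intro y w _ hy hw hyw
          simp only [Finset.mem_filter, Finset.mem_sdiff] at hy
          simp only [Finset.mem_filter, Tuple.mem_M, hQS] at hw
          have hBi : Indep G (B d) := hindep _ d fun x hx => ⟨(hB d x hx).1, (hB d x hx).2.2⟩
          have hyy : ∀ p q, ¬ G.Adj (y p) (y q) := fun p q hpq =>
            hφ _ (hCO (hy p).1.1) _ (hCO (hy q).1.1) hpq ((hy p).2.trans (hy q).2.symm)
          have hBC : ∀ b ∈ B d, ∀ x ∈ C, ¬ G.Adj b x := fun b hb x hx hbx =>
            hC.2.2 x hx b (hB d b hb).1 (hB d b hb).2.1 hbx.symm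
          have hdom : ∀ p, ∃ s ∈ S, G.Adj s (y p) := fun p => hS.2.2 _ (hy p).1.1 (hy p).1.2
          refine hG.not_three_private (S := S) (B := B d) hBi hd.ge hyw hyy ?_ ?_ ?_ ?_ ?_
          · intro p q hpq
            exact hG.exists_common_neighbor hS.2.1 hBi hd.ge (hdom p) (hdom q) (hyy p q)
              ((hyw q q).2 rfl) (fun h => hpq ((hyw p q).1 h)) (hw q).1.2
              (fun b hb s hs => hBC b hb s (hS.1 hs)) fun b hb =>
              ⟨hBC b hb _ (hy p).1.1, hBC b hb _ (hy q).1.1, (hw q).2 b hb⟩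
          · exact fun s hs p => (hw p).1.2 s hs
          · exact fun b hb s hs => hBC b hb s (hS.1 hs)
          · exact fun b hb p => hBC b hb _ (hy p).1.1
          · exact fun b hb p => (hw p).2 b hb)
      exact ⟨A, hA, hAc, fun _ => hAd⟩
    · exact ⟨∅, by simp, by simp, fun h => absurd h hd⟩
  choose A hAsub hAcard hAdom using hAex
  have hA : ∀ c d, ∀ x ∈ A c d, x ∈ C ∧ x ∉ S ∧ φ x = c := fun c d x hx => by
    simpa [and_assoc] using hAsub c d hx
  have hY : ∀ i c l, ∀ x ∈ Y i c l, x ∈ C ∧ x ∈ Q₀.X G i ∧ φ x = c := fun i c l x hx => by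
    simpa [and_assoc] using hYsub i c l hx
  refine ⟨⟨S.card, v, fun i => φ (v i), fun c => Finset.univ.biUnion (A c), B, Y, Z⟩, hQS, hC,
    ?_, hφ, fun _ => rfl, ?_, ?_, ?_, hB, hBcard, ?_, hY, hYcard, ?_, hZ, hZcard, ?_⟩
  · exact (congrArg (IsCDS G C) hQS).mpr hS
  · intro c x hx
    obtain ⟨d, -, hx⟩ := Finset.mem_biUnion.1 hx
    obtain ⟨h1, h2, h3⟩ := hA c d x hx
    exact ⟨h1, fun h => h2 (hQS ▸ h), h3⟩
  · intro c
    refine (Finset.card_biUnion_le_card_mul _ _ 2 fun d _ => hAcard c d).trans ?_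
    simp [mul_comm]
  · intro x hxC hxS w hwM hwW hxw
    have hxS' : x ∉ S := fun h => hxS (hQS.symm ▸ h)
    -- Since `w ∉ W`, some full `B_d` contains no neighbour of `w`.
    obtain ⟨d, hd, hdw⟩ : ∃ d, (B d).card = r ∧ ∀ b ∈ B d, ¬ G.Adj b w := by
      by_contra! hcon
      refine hwW (Finset.mem_filter.2 ⟨hwM, fun d hd => ?_⟩)
      obtain ⟨b, hb, hbw⟩ := hcon d hd
      exact ⟨b, Finset.mem_inter.2 ⟨mem_nbr₁.2 hbw.symm, hb⟩⟩
    obtain ⟨a, ha, haw⟩ := hAdom (φ x) d hd x (by simp [hxC, hxS']) w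
      (Finset.mem_filter.2 ⟨hwM, hdw⟩) hxw
    refine mem_nbr.2 ⟨fun hw => ?_, a, Finset.mem_biUnion.2 ⟨d, Finset.mem_univ _, ha⟩, haw⟩
    obtain ⟨d', -, hw⟩ := Finset.mem_biUnion.1 hw
    have h1 := hA _ _ _ hw
    obtain ⟨s, hs, hsw⟩ := hS.2.2 w h1.1 h1.2.1
    exact (Tuple.mem_M.1 hwM).2 s (hQS.symm ▸ hs) hsw
  · intro c hc x hxO hxC hxc
    have : x ∈ (O \ C).filter fun x => φ x = c := by simp [hxO, hxC, hxc]
    rwa [← hBfull c hc] at this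
  · intro i l hil x hxC hxX hc w hw hxw hwZ
    obtain ⟨y, hy, hyw⟩ := hYdom i (φ x) l hil hc x (by
      exact Finset.mem_filter.2 ⟨Finset.mem_inter.2 ⟨hxC, hxX⟩, rfl⟩) w
      (Finset.mem_sdiff.2 ⟨hw, hwZ⟩) hxw
    refine mem_nbr.2 ⟨fun hwY => ?_, y, hy, hyw⟩
    exact hil.ne (eq_of_mem_X (Q := Q₀) (hY _ _ _ _ hwY).2.1 hw)
  · intro i c hc x hxC hxX hxc
    have : x ∈ (C ∩ Q₀.X G i).filter fun x => φ x = c :=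
      Finset.mem_filter.2 ⟨Finset.mem_inter.2 ⟨hxC, hxX⟩, hxc⟩
    rwa [← hZfull i c hc] at this

end Tuple

/-! ### Repeated exchange of components -/

/-- `C` is the output of the component generation algorithm on some canvas. -/
def IsOutput (G : SimpleGraph V) (r : ℕ) (L : V → Finset (Fin k))
    (U : Finset V → (V → Finset (Fin k)) → Finset V) (C : Finset V) : Prop :=
  ∃ Q : Tuple V k, Q.IsCanvas G r L ∧ C = Q.output G r L U

variable {L : V → Finset (Fin k)} {ω : V → ℝ≥0}
  {U : Finset V → (V → Finset (Fin k)) → Finset V}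

theorem exists_exchange (hG : PathFivePlusFree G r) (hU : IsSolver G ω U) {O C : Finset V}
    (hO : IsOptimum G ω L Finset.univ O) (hC : IsComp G O C) :
    ∃ C', IsOutput G r L U C' ∧ IsOptimum G ω L Finset.univ ((O \ C) ∪ C') ∧
      IsComp G ((O \ C) ∪ C') C' ∧ Disjoint (O \ C) C' := by
  obtain ⟨x, hx⟩ := hC.2.1.1
  obtain ⟨φ₀, -⟩ := hO.2.1
  have : Nonempty (Fin k) := ⟨φ₀ ⟨x, hC.1 hx⟩⟩
  obtain ⟨φ, hL, hφ⟩ := listColorable_iff.1 hO.2.1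
  obtain ⟨S, hS, hcard⟩ := IsCDS.exists_card_le hG hC.2.1 φ fun u hu v hv =>
    hφ u (hC.1 hu) v (hC.1 hv)
  obtain ⟨Q, rfl, hQ⟩ := Tuple.exists_guided hG hC hφ hS
  exact ⟨_, ⟨Q, hQ.isCanvas hL hcard, rfl⟩, hQ.exchange hU hL hO⟩

theorem exists_isOptimum (G : SimpleGraph V) (ω : V → ℝ≥0) (L : V → Finset (Fin k)) :
    ∃ O, IsOptimum G ω L Finset.univ O := by
  obtain ⟨O, hO, hmax⟩ := Finset.exists_max_image
    (Finset.univ.filter fun T : Finset V => ListColorable G L T) (fun T => ∑ v ∈ T, ω v)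
    ⟨∅, by
      simp only [Finset.mem_filter, Finset.mem_univ, true_and]
      exact ⟨SimpleGraph.Coloring.mk (fun v => absurd v.2 (by simp))
        fun {u} => absurd u.2 (by simp), fun v => absurd v.2 (by simp)⟩⟩
  exact ⟨O, Finset.subset_univ _, (Finset.mem_filter.1 hO).2,
    fun T' _ hT' => hmax T' (by simpa using hT')⟩

theorem exists_isOptimum_forall_isOutput (hG : PathFivePlusFree G r) (hU : IsSolver G ω U) :
    ∃ O, IsOptimum G ω L Finset.univ O ∧ ∀ C, IsComp G O C → IsOutput G r L U C := by
  let bad : Finset V → Finset (Finset V) := fun O =>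
    Finset.univ.filter fun C => IsComp G O C ∧ ¬ IsOutput G r L U C
  obtain ⟨O, hO, hmin⟩ := Finset.exists_min_image
    (Finset.univ.filter fun O => IsOptimum G ω L Finset.univ O) (fun O => (bad O).card)
    (by simpa [Finset.Nonempty] using exists_isOptimum G ω L)
  have hO' := (Finset.mem_filter.1 hO).2
  refine ⟨O, hO', fun C hC => ?_⟩
  by_contra hbad
  obtain ⟨C', hC'out, hopt, hC', hdisj⟩ := exists_exchange (r := r) hG hU hO' hC
  -- A bad component of the new optimum cannot meet the component `C'`, which is an output. So it
  -- lies in `O \ C` and was a component of `O` already, while `C` is no longer counted.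
  have hlt : bad ((O \ C) ∪ C') ⊂ bad O := by
    refine Finset.ssubset_iff_subset_ne.2 ⟨?_, ?_⟩
    all_goals
      have key : ∀ E ∈ bad ((O \ C) ∪ C'), E ⊆ O \ C ∧ IsComp G ((O \ C) ∪ C') E ∧
          ¬ IsOutput G r L U E := by
        intro E hE
        obtain ⟨hE, hEbad⟩ := (Finset.mem_filter.1 hE).2
        have hdis : ∀ x ∈ E, x ∉ C' := by
          intro x hx hxC'
          have hsub : E ⊆ C' := by
            by_contra hns
            obtain ⟨a, ha, b, hb, hbn, hab⟩ := hE.2.1.2 (E ∩ C') Finset.inter_subset_left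
              ⟨x, Finset.mem_inter.2 ⟨hx, hxC'⟩⟩ fun h => hns (Finset.inter_eq_left.1 h)
            exact hC'.2.2 a (Finset.mem_inter.1 ha).2 b (hE.1 hb)
              (fun h => hbn (Finset.mem_inter.2 ⟨hb, h⟩)) hab
          refine hEbad ?_
          by_cases hEC : E = C'
          · rwa [hEC]
          · obtain ⟨a, ha, b, hb, hbE, hab⟩ := hC'.2.1.2 E hsub ⟨x, hx⟩ hEC
            exact absurd hab (hE.2.2 a ha b (hC'.1 hb) hbE)
        exact ⟨fun x hx => (Finset.mem_union.1 (hE.1 hx)).resolve_right (hdis x hx), hE, hEbad⟩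
    · intro E hE
      obtain ⟨hsub, hE, hEbad⟩ := key E hE
      refine Finset.mem_filter.2 ⟨Finset.mem_univ _,
        ⟨hsub.trans Finset.sdiff_subset, hE.2.1, fun u hu v hv hvE huv => ?_⟩, hEbad⟩
      by_cases hvC : v ∈ C
      · have := Finset.mem_sdiff.1 (hsub hu)
        exact hC.2.2 v hvC u this.1 this.2 huv.symm
      · exact hE.2.2 u hu v (Finset.mem_union_left _ (Finset.mem_sdiff.2 ⟨hv, hvC⟩)) hvE huv
    · intro heq
      have hCbad : C ∈ bad ((O \ C) ∪ C') := by
        rw [heq]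
        exact Finset.mem_filter.2 ⟨Finset.mem_univ _, hC, hbad⟩
      obtain ⟨x, hx⟩ := hC.2.1.1
      exact (Finset.mem_sdiff.1 ((key C hCbad).1 hx)).2 hx
  exact absurd (hmin _ (Finset.mem_filter.2 ⟨Finset.mem_univ _, hopt⟩))
    (not_le.2 (Finset.card_lt_card hlt))

end Canvas

end ListWMkCIS

theorem mainTheorem7 {V : Type*} [Fintype V] (k r : ℕ) (G : SimpleGraph V)
    (hG : ListWMkCIS.PathFivePlusFree G r) (ω : V → NNReal) (L : V → Finset (Fin k))
    (U : Finset V → (V → Finset (Fin k)) → Finset V) (hU : ListWMkCIS.IsSolver G ω U) :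
    ∃ OPT : Finset V, ListWMkCIS.IsOptimum G ω L Finset.univ OPT ∧
      ∀ C : (G.induce (OPT : Set V)).ConnectedComponent,
        ∃ Q : ListWMkCIS.Tuple V k, Q.IsCanvas G r L ∧
          (Subtype.val '' C.supp : Set V) = (Q.output G r L U : Set V) := by
  obtain ⟨O, hO, hout⟩ := ListWMkCIS.exists_isOptimum_forall_isOutput (L := L) hG hU
  refine ⟨O, hO, fun c => ?_⟩
  obtain ⟨C, hC, hCc⟩ := ListWMkCIS.exists_isComp_eq_supp c
  obtain ⟨Q, hQ, rfl⟩ := hout C hC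
  exact ⟨Q, hQ, hCc.symm⟩
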